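/- Let $Q>0$ and let $(Y_i)_{i\ge 1}$ be a fixed sequence of binary responses, $Y_i\in\{0,1\}$, with success proportions $\hat p_n = n^{-1}\sum_{i=1}^n Y_i$. For each $n$ consider the intercept-only Bayesian probit model for $\mathcal D_n=(Y_1,\dots,Y_n)$, namely $Y_i\mid B\sim \mathrm{Bernoulli}(\Phi(B))$ independently (one covariate, $X_i=1$) with prior $B\sim N(0,Q^{-1})$, where $\Phi$ is the standard normal distribution function. Let $\Pi_n$ be its posterior distribution on $\mathbb R$, with density proportional to $\Phi(\beta)^{n\hat p_n}(1-\Phi(\beta))^{n(1-\hat p_n)}e^{-Q\beta^2/2}$, and let $K_n$ be the Markov transition function of the Albert and Chib data augmentation chain: from $\beta$, draw $Z_1,\dots,Z_n$ independently, $Z_i$ from $N(\beta,1)$ truncated to $(0,\infty)$ if $Y_i=1$ and to $(-\infty,0)$ if $Y_i=0$; then draw the new state from $N\big((n+Q)^{-1}\sum_{i=1}^n Z_i,\,(n+Q)^{-1}\big)$. Let $\rho_*(\mathcal D_n)$ be the infimum of all $\rho\in[0,1]$ for which there is $M:\mathbb R\to[0,\infty)$ with $\|K_n^m(\beta,\cdot)-\Pi_n\|_{\mathrm{TV}}\le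 M(\beta)\rho^m$ for all $\beta\in\mathbb R$ and $m\in\mathbb N$. Let $\rho_{**}(\mathcal D_n)$ be the infimum of all $\rho\in[0,1]$ such that for each probability measure $\nu\ll\Pi_n$ with $\int (d\nu/d\Pi_n)^2\,d\Pi_n<\infty$ there is $M_\nu<\infty$ with $\|\nu K_n^m-\Pi_n\|_{\mathrm{TV}}\le M_\nu\rho^m$ for all $m\in\mathbb N$. Suppose that $0<\liminf_{n\to\infty}\hat p_n\le\limsup_{n\to\infty}\hat p_n<1$, and put $$\lambda_0=\Big[1-\frac2\pi\min\Big\{\liminf_{n\to\infty}\hat p_n,\;1-\limsup_{n\to\infty}\hat p_n\Big\}\Big]^2 .$$ Let $\delta\in(0,1-\lambda_0)$, $\lambda=\lambda_0+\delta$, $L=1+\lambda$, $d>2L/(1-\lambda)$ and $\varepsilon=2^{-1/2}e^{-d}$, and for $r\in(0,1)$ let $$\hat\rho(r)=\max\Big\{(1-\varepsilon)^r,\;\Big(\frac{1+2L+\lambda d}{1+d}\Big)^{1-r}\big(1+2(\lambda d+L)\big)^r\Big\}.$$ Then $\limsup_{n\to\infty}\rho_*(\mathcal D_n)\le\hat\rho(r)$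 and $\limsup_{n\to\infty}\rho_{**}(\mathcal D_n)\le\hat\rho(r)$ for every $r\in(0,1)$, and $\hat\rho(r)<1$ for some $r\in(0,1)$. -/

import Mathlib

open MeasureTheory ProbabilityTheory Filter Set
open scoped ENNReal NNReal

noncomputable section

/-! ## Convergence rates of a Markov chain -/

section Rates

variable {S : Type*} [MeasurableSpace S]

/-- The total variation norm `‖μ - ν‖_TV` of the difference of two finite measures. -/
def tvNorm (μ ν : Measure S) [IsFiniteMeasure μ] [IsFiniteMeasure ν] : ℝ :=
  (μ.toSignedMeasure - ν.toSignedMeasure).totalVariation.real univ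

instance isMarkovKernel_pow (K : Kernel S S) [IsMarkovKernel K] (m : ℕ) :
    IsMarkovKernel (K ^ m) := by
  induction m with
  | zero => exact inferInstanceAs (IsMarkovKernel (Kernel.id : Kernel S S))
  | succ m ih =>
    rw [pow_succ]
    exact inferInstanceAs (IsMarkovKernel ((K ^ m) ∘ₖ K))

/-- The geometric convergence rate `ρ_*` of the chain with Markov transition function `K` and
invariant distribution `P`: the infimum of all `ρ ∈ [0,1]` such that, for some
`M : S → [0,∞)`, `‖K^m(x,·) - P‖_TV ≤ M(x) ρ^m` for all `x` and `m`. -/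
def geomRate (K : Kernel S S) [IsMarkovKernel K] (P : Measure S) [IsFiniteMeasure P] : ℝ :=
  sInf {ρ : ℝ | ρ ∈ Icc (0 : ℝ) 1 ∧
    ∃ M : S → ℝ≥0, ∀ (x : S) (m : ℕ), tvNorm ((K ^ m) x) P ≤ M x * ρ ^ m}

/-- `ν ∈ L²(P)`: the measure `ν` is absolutely continuous with respect to `P`, with a density
that is square integrable with respect to `P`. -/
def MemL2 (ν P : Measure S) : Prop :=
  ν ≪ P ∧ ∫⁻ x, (ν.rnDeriv P x) ^ 2 ∂P < ∞

/-- The `L²`-geometric convergence rate `ρ_**` of the chain with Markov transition function `K`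
and invariant distribution `P`: the infimum of all `ρ ∈ [0,1]` such that for each probability
measure `ν ∈ L²(P)` there is `M_ν < ∞` with `‖νK^m - P‖_TV ≤ M_ν ρ^m` for all `m`. -/
def l2GeomRate (K : Kernel S S) [IsMarkovKernel K] (P : Measure S) [IsFiniteMeasure P] : ℝ :=
  sInf {ρ : ℝ | ρ ∈ Icc (0 : ℝ) 1 ∧
    ∀ (ν : Measure S) [IsProbabilityMeasure ν], MemL2 ν P →
      ∃ M : ℝ, ∀ m : ℕ, tvNorm (ν.bind (K ^ m)) P ≤ M * ρ ^ m}

end Rates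

/-- Rosenthal's bound
`(1-ε)^r ∨ ((1+2L+λd)/(1+d))^(1-r) (1+2(λd+L))^r` on the geometric convergence rate, computed
from drift parameters `lam`, `L`, minorization number `ε`, size `d` of the small set, and a free
parameter `r ∈ (0,1)`. -/
def rosenthalRate (lam L ε d r : ℝ) : ℝ :=
  max ((1 - ε) ^ r)
    (((1 + 2 * L + lam * d) / (1 + d)) ^ (1 - r) * (1 + 2 * (lam * d + L)) ^ r)

/-! ## Albert and Chib's chain for Bayesian probit regression with a single covariate -/

/-- The standard normal distribution function `Φ`. -/
def stdNormalCDF (t : ℝ) : ℝ := cdf (gaussianReal 0 1) t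

/-- The half-line `(0,∞)` for a success, and `(-∞,0)` for a failure. -/
def halfLine (b : Bool) : Set ℝ := if b then Ioi 0 else Iio 0

/-- The truncated normal distribution `TN(θ, 1; b)`: the distribution `N(θ,1)` truncated to
`(0,∞)` for a success, and to `(-∞,0)` for a failure. -/
def truncNormal (θ : ℝ) (b : Bool) : Measure ℝ := (gaussianReal θ 1)[|halfLine b]

lemma measurableSet_halfLine (b : Bool) : MeasurableSet (halfLine b) := by
  cases b <;> simp [halfLine]

instance isProbabilityMeasure_truncNormal (θ : ℝ) (b : Bool) :
    IsProbabilityMeasure (truncNormal θ b) := by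
  refine cond_isProbabilityMeasure fun h => ?_
  have h' := gaussianReal_absolutelyContinuous' θ (one_ne_zero (α := ℝ≥0)) h
  cases b <;> simp [halfLine] at h'

lemma measurable_truncNormal (b : Bool) : Measurable fun θ => truncNormal θ b := by
  have hG : Measurable fun θ : ℝ => gaussianReal θ 1 :=
    measurable_gaussianReal.comp (measurable_id.prodMk measurable_const)
  refine Measure.measurable_of_measurable_coe _ fun s hs => ?_
  simp only [truncNormal, cond_apply (measurableSet_halfLine b)]
  exact ((Measure.measurable_coe (measurableSet_halfLine b)).comp hG).inv.mul
    ((Measure.measurable_coe ((measurableSet_halfLine b).inter hs)).comp hG)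

section AlbertChib

variable {ι : Type*} [Fintype ι]

/-- The first step of an iteration, as a Markov kernel: given the current state `β`, draw
independent `Z_i ∼ TN(x_i β, 1; y_i)`. -/
def latentKernel (x : ι → ℝ) (y : ι → Bool) : Kernel ℝ (ι → ℝ) where
  toFun β := Measure.pi fun i => truncNormal (x i * β) (y i)
  measurable' := by
    refine Measurable.measure_of_isPiSystem_of_isProbabilityMeasure generateFrom_pi.symm
      isPiSystem_pi ?_
    rintro _ ⟨s, hs, rfl⟩
    simp only [Measure.pi_pi]
    have hs' : ∀ i, MeasurableSet (s i) := fun i => hs i (mem_univ i)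
    exact Finset.measurable_prod _ fun i _ =>
      (Measure.measurable_coe (hs' i)).comp
        ((measurable_truncNormal (y i)).comp (measurable_const.mul measurable_id))

instance (x : ι → ℝ) (y : ι → Bool) : IsMarkovKernel (latentKernel x y) :=
  ⟨fun β => inferInstanceAs
    (IsProbabilityMeasure (Measure.pi fun i => truncNormal (x i * β) (y i)))⟩

/-- The second step of an iteration, as a Markov kernel: given `z`, draw the new state from
`N(Σ⁻¹ (xᵀz + Qv), Σ⁻¹)`, where `Σ = xᵀx + Q`. -/
def coefKernel (x : ι → ℝ) (v Q : ℝ) : Kernel (ι → ℝ) ℝ where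
  toFun z := gaussianReal ((∑ i, x i ^ 2 + Q)⁻¹ * (∑ i, x i * z i + Q * v))
    (Real.toNNReal (∑ i, x i ^ 2 + Q)⁻¹)
  measurable' := measurable_gaussianReal.comp
    (Measurable.prodMk (by fun_prop) measurable_const)

instance (x : ι → ℝ) (v Q : ℝ) : IsMarkovKernel (coefKernel x v Q) :=
  ⟨fun _ => inferInstanceAs (IsProbabilityMeasure (gaussianReal _ _))⟩

/-- The Markov transition function of Albert and Chib's data augmentation chain, for covariates
`x`, responses `y` (`true` is a success), prior mean `v` and prior precision `Q`. -/
def acKernel (x : ι → ℝ) (y : ι → Bool) (v Q : ℝ) : Kernel ℝ ℝ :=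
  coefKernel x v Q ∘ₖ latentKernel x y

instance (x : ι → ℝ) (y : ι → Bool) (v Q : ℝ) : IsMarkovKernel (acKernel x y v Q) :=
  inferInstanceAs (IsMarkovKernel (coefKernel x v Q ∘ₖ latentKernel x y))

/-- The unnormalized posterior density of the probit regression coefficient: the likelihood
`∏ Φ(x_i β)^{y_i} (1 - Φ(x_i β))^{1 - y_i}` times `exp (-(β - v) Q (β - v) / 2)`. -/
def posteriorWeight (x : ι → ℝ) (y : ι → Bool) (v Q β : ℝ) : ℝ :=
  (∏ i, if y i then stdNormalCDF (x i * β) else 1 - stdNormalCDF (x i * β)) *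
    Real.exp (-(1 / 2) * ((β - v) * Q * (β - v)))

/-- The posterior distribution, whose density is proportional to `posteriorWeight`
(conditioning on the whole space is normalization to total mass one). -/
def posterior (x : ι → ℝ) (y : ι → Bool) (v Q : ℝ) : Measure ℝ :=
  (volume.withDensity fun β => ENNReal.ofReal (posteriorWeight x y v Q β))[|univ]

instance (x : ι → ℝ) (y : ι → Bool) (v Q : ℝ) : IsFiniteMeasure (posterior x y v Q) :=
  inferInstanceAs (IsFiniteMeasure
    (volume.withDensity fun β => ENNReal.ofReal (posteriorWeight x y v Q β))[|univ])

end AlbertChib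

/-! ## The intercept-only model -/

/-- The success proportion `p̂_n` among the first `n` responses. -/
def successProp (Y : ℕ → Bool) (n : ℕ) : ℝ :=
  (∑ i ∈ Finset.range n, if Y i then (1 : ℝ) else 0) / n

/-- `ρ_*(𝒟_n)` in the intercept-only model: one covariate, equal to `1` for each of the first
`n` observations, prior mean `0` and prior precision `Q`. -/
def interceptRate (Q : ℝ) (Y : ℕ → Bool) (n : ℕ) : ℝ :=
  geomRate (acKernel (fun _ : Fin n => (1 : ℝ)) (fun i => Y i) 0 Q)
    (posterior (fun _ : Fin n => (1 : ℝ)) (fun i => Y i) 0 Q)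

/-- `ρ_**(𝒟_n)` in the intercept-only model. -/
def interceptL2Rate (Q : ℝ) (Y : ℕ → Bool) (n : ℕ) : ℝ :=
  l2GeomRate (acKernel (fun _ : Fin n => (1 : ℝ)) (fun i => Y i) 0 Q)
    (posterior (fun _ : Fin n => (1 : ℝ)) (fun i => Y i) 0 Q)

end

noncomputable section

/-! ### Total variation, invariant distributions and square integrable densities. -/

section Rates

variable {S : Type*} [MeasurableSpace S]

/-! No drift or minorization estimate enters: the chain is a Wasserstein contraction, with a
coefficient that is already below `1 - ε`.

Truncated normals with parameter `β` are exponential tilts of those with parameter `0`. Hence the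
law of the latent vector given `β` is an exponential family in `β` with statistic `X = ∑ Z_i`, and
the new state is normal with mean `X / (n + Q)`. Such a family is stochastically monotone and the
derivative of its mean is `Var X`, so averaging an `l`-Lipschitz function of `X` gives an `l
V`-Lipschitz function of `β` if `Var X ≤ V` throughout (`abs_integral_tilted_sub_le`). One
transition therefore multiplies Lipschitz constants by `κ = V / (n + Q)`. Normal noise makes even
indicators Lipschitz after one step, so `m`-step probabilities have Lipschitz constants `C κ ^ m`
(`abs_pow_comp_tilted_gaussian_sub_le`). Integrating against the invariant posterior, which has two
moments, bounds both rates by `κ`.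

Each `Z_i` has variance at most `1`, and at most `1/2` when it is truncated to the side opposite to
its location (`variance_truncNormal_true_le`). Whatever the sign of `β`, this applies to all
successes or to all failures, so `κ ≤ 1 - min (p̂, 1 - p̂) / 2`. With `p` the limiting proportion of
the rarer response, `d > 2L / (1 - λ)` forces `2ε < p` (`two_mul_minorization_lt`), so both upper
limits are at most `1 - ε ≤ (1 - ε) ^ r`. -/

lemma tvNorm_le_two_mul {μ ν : Measure S} [IsFiniteMeasure μ] [IsFiniteMeasure ν] {c : ℝ}
    (h : ∀ A, MeasurableSet A → |μ.real A - ν.real A| ≤ c) : tvNorm μ ν ≤ 2 * c := by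
  set s := μ.toSignedMeasure - ν.toSignedMeasure with hs
  have happ : ∀ A, MeasurableSet A → s A = μ.real A - ν.real A := fun A hA => by
    simp [hs, hA]
  obtain ⟨i, hi, hpos, hneg⟩ := s.toJordanDecomposition.mutuallySingular
  -- By the Hahn decomposition the total variation is `s iᶜ - s i`, and each term contributes at
  -- most `c`.
  have h1 := s.apply_eq_posPart_real_sub_negPart_real hi.compl
  have h2 := s.apply_eq_posPart_real_sub_negPart_real hi
  have hp : s.toJordanDecomposition.posPart.real i = 0 := by simp [measureReal_def, hpos]
  have hn : s.toJordanDecomposition.negPart.real iᶜ = 0 := by simp [measureReal_def, hneg]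
  have hp' := measureReal_add_measureReal_compl (μ := s.toJordanDecomposition.posPart) hi
  have hn' := measureReal_add_measureReal_compl (μ := s.toJordanDecomposition.negPart) hi
  have htv : tvNorm μ ν = s.toJordanDecomposition.posPart.real univ
      + s.toJordanDecomposition.negPart.real univ := by
    rw [tvNorm, ← hs, SignedMeasure.totalVariation, measureReal_add_apply]
  have b1 := (abs_le.1 (h i hi)).1
  have b2 := (abs_le.1 (h iᶜ hi.compl)).2
  rw [happ _ hi.compl] at h1
  rw [happ _ hi] at h2
  linarith

lemma geomRate_nonneg (K : Kernel S S) [IsMarkovKernel K] (P : Measure S) [IsFiniteMeasure P] :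
    0 ≤ geomRate K P :=
  Real.sInf_nonneg fun _ h => h.1.1

lemma l2GeomRate_nonneg (K : Kernel S S) [IsMarkovKernel K] (P : Measure S) [IsFiniteMeasure P] :
    0 ≤ l2GeomRate K P :=
  Real.sInf_nonneg fun _ h => h.1.1

lemma bind_pow_eq_self {K : Kernel S S} {P : Measure S} (h : P.bind K = P) (m : ℕ) :
    P.bind (K ^ m : Kernel S S) = P := by
  induction m with
  | zero => rw [pow_zero]; exact Measure.id_comp
  | succ m ih =>
    rw [pow_succ]
    change ((K ^ m) ∘ₖ K) ∘ₘ P = P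
    rw [← Measure.comp_assoc, h, ih]

lemma measureReal_bind (K : Kernel S S) [IsMarkovKernel K] (ν : Measure S)
    [IsProbabilityMeasure ν] {A : Set S} (hA : MeasurableSet A) :
    (ν.bind K).real A = ∫ x, (K x).real A ∂ν := by
  rw [measureReal_def, Measure.bind_apply hA K.aemeasurable,
    ← integral_toReal (K.measurable_coe hA).aemeasurable (ae_of_all _ fun x => measure_lt_top _ _)]
  rfl

lemma integrable_kernel_real (K : Kernel S S) [IsMarkovKernel K] (ν : Measure S)
    [IsProbabilityMeasure ν] {A : Set S} (hA : MeasurableSet A) :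
    Integrable (fun x => (K x).real A) ν := by
  refine Integrable.of_bound (C := 1) (K.measurable_coe hA).ennreal_toReal.aestronglyMeasurable
    (ae_of_all _ fun x => ?_)
  rw [Real.norm_of_nonneg measureReal_nonneg]
  exact measureReal_le_one

/-- A square integrable function is integrable under every measure in `L²`. -/
lemma MemL2.integrable_of_sq {ν P : Measure S} [IsProbabilityMeasure ν] [IsProbabilityMeasure P]
    (h : MemL2 ν P) {f : S → ℝ} (hf : Measurable f) (hf2 : Integrable (fun x => f x ^ 2) P) :
    Integrable f ν := by
  refine ⟨hf.aestronglyMeasurable, ?_⟩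
  have hm : Measurable fun x => ‖f x‖ₑ := hf.enorm
  rw [HasFiniteIntegral, ← Measure.withDensity_rnDeriv_eq ν P h.1,
    lintegral_withDensity_eq_lintegral_mul _ (Measure.measurable_rnDeriv ν P) hm]
  have hfin : ∫⁻ x, ‖f x‖ₑ ^ 2 ∂P < ∞ := by
    have := hf2.2
    rw [HasFiniteIntegral] at this
    simpa [enorm_pow] using this
  refine lt_of_le_of_lt ?_ (ENNReal.add_lt_top.2 ⟨h.2, hfin⟩)
  rw [← lintegral_add_left ((Measure.measurable_rnDeriv ν P).pow_const 2)]
  refine lintegral_mono fun x => ?_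
  simp only [Pi.mul_apply, sq]
  rcases le_total (ν.rnDeriv P x) ‖f x‖ₑ with hle | hle
  · exact (mul_le_mul' hle le_rfl).trans le_add_self
  · exact (mul_le_mul' le_rfl hle).trans le_self_add

end Rates

/-! ### From Lipschitz transition probabilities to convergence rates. -/

section Contraction

variable {K : Kernel ℝ ℝ} [IsMarkovKernel K] {P : Measure ℝ} [IsProbabilityMeasure P] {C κ : ℝ}

/-- Invariance makes `P A` the `P`-average of the `m`-step probabilities, so the Lipschitz bound can
be averaged over the second starting point. The case `m = 0` is excluded because `K ^ 0` gives
indicators, which need not be Lipschitz. -/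
lemma abs_pow_sub_invariant_le (hinv : P.bind K = P) (hP1 : Integrable (fun x : ℝ => |x|) P)
    (hC : 0 ≤ C) (hκ : 0 ≤ κ)
    (hlip : ∀ m : ℕ, m ≠ 0 → ∀ A, MeasurableSet A → ∀ x y : ℝ,
      |((K ^ m) x).real A - ((K ^ m) y).real A| ≤ C * κ ^ m * |x - y|)
    {m : ℕ} (hm : m ≠ 0) {A : Set ℝ} (hA : MeasurableSet A) (x : ℝ) :
    |((K ^ m) x).real A - P.real A| ≤ C * κ ^ m * (|x| + ∫ y, |y| ∂P) := by
  have hc : 0 ≤ C * κ ^ m := mul_nonneg hC (pow_nonneg hκ m)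
  have hPA : P.real A = ∫ y, ((K ^ m) y).real A ∂P := by
    rw [← measureReal_bind (K ^ m) P hA, bind_pow_eq_self hinv]
  have hint := integrable_kernel_real (K ^ m) P hA
  have : ((K ^ m) x).real A - P.real A
      = ∫ y, (((K ^ m) x).real A - ((K ^ m) y).real A) ∂P := by
    rw [integral_sub (integrable_const _) hint, ← hPA]; simp
  rw [this]
  calc |∫ y, (((K ^ m) x).real A - ((K ^ m) y).real A) ∂P|
      ≤ ∫ y, |((K ^ m) x).real A - ((K ^ m) y).real A| ∂P := abs_integral_le_integral_abs
    _ ≤ ∫ y, C * κ ^ m * (|x| + |y|) ∂P := by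
        refine integral_mono ((integrable_const _).sub hint).abs
          (((integrable_const _).add hP1).const_mul _) fun y => ?_
        exact (hlip m hm A hA x y).trans (mul_le_mul_of_nonneg_left (abs_sub x y) hc)
    _ = C * κ ^ m * (|x| + ∫ y, |y| ∂P) := by
        rw [integral_const_mul, integral_add (integrable_const _) hP1]; simp

lemma abs_measureReal_sub_le_one (μ ν : Measure ℝ) [IsProbabilityMeasure μ]
    [IsProbabilityMeasure ν] (A : Set ℝ) : |μ.real A - ν.real A| ≤ 1 := by
  have h1 : μ.real A ≤ 1 := measureReal_le_one
  have h2 : ν.real A ≤ 1 := measureReal_le_one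
  have h3 : 0 ≤ μ.real A := measureReal_nonneg
  have h4 : 0 ≤ ν.real A := measureReal_nonneg
  rw [abs_le]; constructor <;> linarith

/-- A chain whose `m`-step transition probabilities are Lipschitz with constant `C * κ ^ m`, with
an invariant distribution that has a first moment, has geometric convergence rate at most `κ`. -/
lemma geomRate_le_of_lipschitz (hinv : P.bind K = P) (hP1 : Integrable (fun x : ℝ => |x|) P)
    (hC : 0 ≤ C) (hκ : κ ∈ Icc (0 : ℝ) 1)
    (hlip : ∀ m : ℕ, m ≠ 0 → ∀ A, MeasurableSet A → ∀ x y : ℝ,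
      |((K ^ m) x).real A - ((K ^ m) y).real A| ≤ C * κ ^ m * |x - y|) :
    geomRate K P ≤ κ := by
  have hI : 0 ≤ ∫ y, |y| ∂P := integral_nonneg fun _ => abs_nonneg _
  refine csInf_le ⟨0, fun _ h => h.1.1⟩ ⟨hκ, fun x =>
    -- The summand `1` covers `m = 0`; the factor `2` comes from passing from sets to the total
    -- variation norm.
    ⟨2 * (1 + C * (|x| + ∫ y, |y| ∂P)), by positivity⟩, fun x m => ?_⟩
  have hB : 0 ≤ C * (|x| + ∫ y, |y| ∂P) := by positivity
  change _ ≤ 2 * (1 + C * (|x| + ∫ y, |y| ∂P)) * κ ^ m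
  rw [mul_assoc]
  refine tvNorm_le_two_mul fun A hA => ?_
  rcases eq_or_ne m 0 with rfl | hm
  · refine (abs_measureReal_sub_le_one _ _ A).trans ?_
    rw [pow_zero]; linarith
  · refine (abs_pow_sub_invariant_le hinv hP1 hC hκ.1 hlip hm hA x).trans ?_
    have := pow_nonneg hκ.1 m
    nlinarith

/-- The `L²` version of `geomRate_le_of_lipschitz`, for an invariant distribution that has a
second moment. -/
lemma l2GeomRate_le_of_lipschitz (hinv : P.bind K = P) (hP1 : Integrable (fun x : ℝ => |x|) P)
    (hP2 : Integrable (fun x : ℝ => x ^ 2) P) (hC : 0 ≤ C) (hκ : κ ∈ Icc (0 : ℝ) 1)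
    (hlip : ∀ m : ℕ, m ≠ 0 → ∀ A, MeasurableSet A → ∀ x y : ℝ,
      |((K ^ m) x).real A - ((K ^ m) y).real A| ≤ C * κ ^ m * |x - y|) :
    l2GeomRate K P ≤ κ := by
  have hI : 0 ≤ ∫ y, |y| ∂P := integral_nonneg fun _ => abs_nonneg _
  refine csInf_le ⟨0, fun _ h => h.1.1⟩ ⟨hκ, fun ν _ hν =>
    ⟨2 * (1 + C * (∫ x, |x| ∂ν + ∫ y, |y| ∂P)), fun m => ?_⟩⟩
  have hν1 : Integrable (fun x : ℝ => |x|) ν := (hν.integrable_of_sq measurable_id hP2).abs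
  have hI' : 0 ≤ ∫ y, |y| ∂ν := integral_nonneg fun _ => abs_nonneg _
  have hB : 0 ≤ C * (∫ x, |x| ∂ν + ∫ y, |y| ∂P) := by positivity
  rw [mul_assoc]
  refine tvNorm_le_two_mul fun A hA => ?_
  rcases eq_or_ne m 0 with rfl | hm
  · refine (abs_measureReal_sub_le_one _ _ A).trans ?_
    rw [pow_zero]; linarith
  · have hint := integrable_kernel_real (K ^ m) ν hA
    have : (ν.bind (K ^ m : Kernel ℝ ℝ)).real A - P.real A
        = ∫ x, (((K ^ m) x).real A - P.real A) ∂ν := by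
      rw [integral_sub hint (integrable_const _), measureReal_bind (K ^ m) ν hA]; simp
    rw [this]
    calc |∫ x, (((K ^ m) x).real A - P.real A) ∂ν|
        ≤ ∫ x, |((K ^ m) x).real A - P.real A| ∂ν := abs_integral_le_integral_abs
      _ ≤ ∫ x, C * κ ^ m * (|x| + ∫ y, |y| ∂P) ∂ν := by
          refine integral_mono (hint.sub (integrable_const _)).abs
            ((hν1.add (integrable_const _)).const_mul _) fun x => ?_
          exact abs_pow_sub_invariant_le hinv hP1 hC hκ.1 hlip hm hA x
      _ = C * κ ^ m * (∫ x, |x| ∂ν + ∫ y, |y| ∂P) := by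
          rw [integral_const_mul, integral_add hν1 (integrable_const _)]; simp
      _ ≤ _ := by
          have := pow_nonneg hκ.1 m
          nlinarith

end Contraction

/-! ### One-parameter exponential families. -/

section ExponentialFamily

variable {Ω : Type*} [MeasurableSpace Ω] {P : Measure Ω} {X : Ω → ℝ}

lemma mem_interior_integrableExpSet (hexp : ∀ t, Integrable (fun ω => Real.exp (t * X ω)) P)
    (t : ℝ) : t ∈ interior (integrableExpSet X P) := by
  have : integrableExpSet X P = univ := eq_univ_of_forall hexp
  simp [this]

variable [IsProbabilityMeasure P]

lemma integrable_tilted_of_lipschitz (hexp : ∀ t, Integrable (fun ω => Real.exp (t * X ω)) P)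
    {g : ℝ → ℝ} {l : ℝ} (hg : ∀ x y, |g x - g y| ≤ l * |x - y|) (t : ℝ) :
    Integrable (fun ω => g (X ω)) (P.tilted (t * X ·)) := by
  have : IsProbabilityMeasure (P.tilted (t * X ·)) := isProbabilityMeasure_tilted (hexp t)
  have hX : Integrable X (P.tilted (t * X ·)) :=
    memLp_one_iff_integrable.1 (memLp_tilted_mul (mem_interior_integrableExpSet hexp t) 1)
  have hgc : Continuous g := by
    refine (LipschitzWith.of_dist_le_mul (K := l.toNNReal) fun x y => ?_).continuous
    rw [Real.dist_eq, Real.dist_eq]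
    exact (hg x y).trans (mul_le_mul_of_nonneg_right (Real.le_coe_toNNReal l) (abs_nonneg _))
  refine Integrable.mono' ((hX.abs.const_mul l).add (integrable_const |g 0|))
    (hgc.comp_aestronglyMeasurable hX.aestronglyMeasurable) (ae_of_all _ fun ω => ?_)
  have h1 := hg (X ω) 0
  rw [sub_zero] at h1
  have h2 := abs_sub_abs_le_abs_sub (g (X ω)) (g 0)
  simp only [Pi.add_apply, Real.norm_eq_abs]
  linarith

/-- An exponential family is stochastically monotone in its parameter. -/
lemma integral_tilted_mono (hexp : ∀ t, Integrable (fun ω => Real.exp (t * X ω)) P)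
    {g : ℝ → ℝ} (hg : Monotone g)
    (hint : ∀ t, Integrable (fun ω => g (X ω)) (P.tilted (t * X ·))) {t u : ℝ} (htu : t ≤ u) :
    ∫ ω, g (X ω) ∂P.tilted (t * X ·) ≤ ∫ ω, g (X ω) ∂P.tilted (u * X ·) := by
  rcases htu.eq_or_lt with rfl | htu
  · exact le_rfl
  set e : ℝ → Ω → ℝ := fun t ω => Real.exp (t * X ω - cgf X P t) with he
  have he_int : ∀ t, Integrable (e t) P := fun t => by
    simp only [he, Real.exp_sub]
    exact (hexp t).div_const _
  have he_one : ∀ t, ∫ ω, e t ω ∂P = 1 := fun t => by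
    have : IsProbabilityMeasure (P.tilted (t * X ·)) := isProbabilityMeasure_tilted (hexp t)
    have h := integral_tilted_mul_eq_cgf (fun _ : Ω => (1 : ℝ)) (hexp t)
    simpa using h.symm
  have hge : ∀ t, Integrable (fun ω => e t ω * g (X ω)) P := fun t => by
    have h := (integrable_tilted_iff (hexp t) _).1 (hint t)
    refine (h.div_const (Real.exp (cgf X P t))).congr (ae_of_all _ fun ω => ?_)
    simp only [he, Real.exp_sub, smul_eq_mul]
    ring
  rw [integral_tilted_mul_eq_cgf _ (hexp t), integral_tilted_mul_eq_cgf _ (hexp u), ← sub_nonneg]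
  simp only [smul_eq_mul]
  -- The two densities cross where `X = s`, so `e u - e t` and `g (X ·) - g s` have the same sign.
  -- Subtracting the constant `g s` is harmless since both densities integrate to `1`.
  set s := (cgf X P u - cgf X P t) / (u - t) with hs
  have hut : 0 < u - t := sub_pos.2 htu
  have hsu : cgf X P u - cgf X P t = (u - t) * s := by rw [hs]; field_simp
  have key : ∫ ω, (e u ω * g (X ω) - e t ω * g (X ω) - g s * (e u ω - e t ω)) ∂P
      = ∫ ω, e u ω * g (X ω) ∂P - ∫ ω, e t ω * g (X ω) ∂P := by
    have h1 : Integrable (fun ω => e u ω * g (X ω) - e t ω * g (X ω)) P := (hge u).sub (hge t)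
    have h2 : Integrable (fun ω => g s * (e u ω - e t ω)) P :=
      ((he_int u).sub (he_int t)).const_mul _
    rw [integral_sub h1 h2, integral_sub (hge u) (hge t), integral_const_mul,
      integral_sub (he_int u) (he_int t), he_one, he_one]
    ring
  change 0 ≤ ∫ ω, e u ω * g (X ω) ∂P - ∫ ω, e t ω * g (X ω) ∂P
  rw [← key]
  refine integral_nonneg fun ω => ?_
  have hfac : e u ω * g (X ω) - e t ω * g (X ω) - g s * (e u ω - e t ω)
      = (e u ω - e t ω) * (g (X ω) - g s) := by ring
  simp only [Pi.zero_apply]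
  rw [hfac]
  rcases le_total (X ω) s with h | h
  · refine mul_nonneg_of_nonpos_of_nonpos (sub_nonpos.2 (Real.exp_le_exp.2 ?_))
      (sub_nonpos.2 (hg h))
    nlinarith
  · refine mul_nonneg (sub_nonneg.2 (Real.exp_le_exp.2 ?_)) (sub_nonneg.2 (hg h))
    nlinarith

/-- In an exponential family, the mean of a Lipschitz function of `X` varies at most as much as
`l` times the mean of `X`. -/
lemma abs_integral_tilted_sub_le (hexp : ∀ t, Integrable (fun ω => Real.exp (t * X ω)) P)
    {g : ℝ → ℝ} {l : ℝ} (hg : ∀ x y, |g x - g y| ≤ l * |x - y|) {V : ℝ}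
    (hV : ∀ t, iteratedDeriv 2 (cgf X P) t ≤ V) (t u : ℝ) :
    |∫ ω, g (X ω) ∂P.tilted (t * X ·) - ∫ ω, g (X ω) ∂P.tilted (u * X ·)|
      ≤ l * V * |t - u| := by
  have hint := mem_interior_integrableExpSet hexp
  have hl : 0 ≤ l := by simpa using (abs_nonneg _).trans (hg 1 0)
  wlog htu : t ≤ u generalizing t u
  · rw [abs_sub_comm, abs_sub_comm t]
    exact this u t (le_of_not_ge htu)
  have hX : ∀ t, Integrable X (P.tilted (t * X ·)) := fun t =>
    memLp_one_iff_integrable.1 (memLp_tilted_mul (hint t) 1)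
  have hgi := integrable_tilted_of_lipschitz hexp hg
  have hmean : ∀ t, ∫ ω, X ω ∂P.tilted (t * X ·) = deriv (cgf X P) t := fun t =>
    integral_tilted_mul_self (hint t)
  have hdiff : Differentiable ℝ (deriv (cgf X P)) := fun t =>
    (analyticAt_cgf (hint t)).deriv.differentiableAt
  have hderiv : deriv (cgf X P) u - deriv (cgf X P) t ≤ V * (u - t) :=
    image_sub_le_mul_sub_of_deriv_le hdiff (fun x => by
      have := hV x
      rwa [iteratedDeriv_succ, iteratedDeriv_one] at this) htu
  -- For `|c| ≤ 1` the function `l x + c g(x)` is nondecreasing. The cases `c = 1` and `c = -1`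
  -- bound the change in the mean of `g` by `l` times the change in the mean of `X`.
  have hmono : ∀ c : ℝ, |c| ≤ 1 → l * ∫ ω, X ω ∂P.tilted (t * X ·)
      + c * ∫ ω, g (X ω) ∂P.tilted (t * X ·) ≤ l * ∫ ω, X ω ∂P.tilted (u * X ·)
      + c * ∫ ω, g (X ω) ∂P.tilted (u * X ·) := fun c hc => by
    have h := integral_tilted_mono hexp (g := fun x => l * x + c * g x)
      (fun x y hxy => by
        have h1 : |c * (g x - g y)| ≤ l * (y - x) := by
          rw [abs_mul]
          have h2 := hg x y
          rw [abs_sub_comm x, abs_of_nonneg (sub_nonneg.2 hxy)] at h2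
          have := mul_le_mul hc h2 (abs_nonneg _) zero_le_one
          rwa [one_mul] at this
        have := (abs_le.1 h1).2
        simp only
        nlinarith)
      (fun t => ((hX t).const_mul l).add ((hgi t).const_mul c)) htu
    simpa only [integral_add ((hX _).const_mul l) ((hgi _).const_mul c), integral_const_mul]
      using h
  have h1 := hmono 1 (by simp)
  have h2 := hmono (-1) (by simp)
  rw [hmean, hmean] at h1 h2
  have h3 := mul_le_mul_of_nonneg_left hderiv hl
  rw [abs_sub_comm t, abs_of_nonneg (sub_nonneg.2 htu), abs_le]
  constructor <;> nlinarith

end ExponentialFamily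

/-! ### Normal location families. -/

section Gaussian

lemma gaussianReal_map_shift (a : ℝ) (s : ℝ≥0) :
    gaussianReal a s = (gaussianReal 0 s).map (a + ·) := by
  rw [gaussianReal_map_const_add, zero_add]

/-- Couple the two normal variables through the same centred noise; they then differ by exactly `a -
b`. -/
lemma abs_integral_gaussianReal_sub_le {f : ℝ → ℝ} (hf : Measurable f) {B l : ℝ}
    (hB : ∀ x, |f x| ≤ B) (hl : ∀ x y, |f x - f y| ≤ l * |x - y|) (a b : ℝ) (s : ℝ≥0) :
    |∫ y, f y ∂gaussianReal a s - ∫ y, f y ∂gaussianReal b s| ≤ l * |a - b| := by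
  have hi : ∀ c : ℝ, Integrable (fun y => f (c + y)) (gaussianReal 0 s) := fun c =>
    Integrable.of_bound (C := B) (hf.comp (measurable_const_add c)).aestronglyMeasurable
      (ae_of_all _ fun y => hB _)
  rw [gaussianReal_map_shift a, gaussianReal_map_shift b,
    integral_map (by fun_prop) hf.aestronglyMeasurable,
    integral_map (by fun_prop) hf.aestronglyMeasurable, ← integral_sub (hi a) (hi b)]
  refine abs_integral_le_integral_abs.trans ?_
  calc ∫ y, |f (a + y) - f (b + y)| ∂gaussianReal 0 s
      ≤ ∫ _, l * |a - b| ∂gaussianReal 0 s := by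
        refine integral_mono ((hi a).sub (hi b)).abs (integrable_const _) fun y => ?_
        simpa using hl (a + y) (b + y)
    _ = l * |a - b| := by simp

/-- The normal location family is Lipschitz in total variation. -/
lemma abs_gaussianReal_real_sub_le {s : ℝ≥0} (hs : s ≠ 0) {A : Set ℝ} (hA : MeasurableSet A)
    (a b : ℝ) :
    |(gaussianReal a s).real A - (gaussianReal b s).real A|
      ≤ (√(2 * Real.pi * s))⁻¹ * |a - b| := by
  have key : ∀ {a b : ℝ}, a < b → ∀ {A : Set ℝ}, MeasurableSet A →
      (gaussianReal a s).real A - (gaussianReal b s).real A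
        ≤ (√(2 * Real.pi * s))⁻¹ * (b - a) := by
    intro a b hab A hA
    have hreal : ∀ (c : ℝ) (B : Set ℝ),
        (gaussianReal c s).real B = ∫ x in B, gaussianPDFReal c s x := fun c B => by
      rw [measureReal_def, gaussianReal_apply_eq_integral c hs, ENNReal.toReal_ofReal]
      exact integral_nonneg fun x => gaussianPDFReal_nonneg c s x
    have hi : ∀ c, Integrable (gaussianPDFReal c s) := fun c => integrable_gaussianPDFReal c s
    have hs' : (0 : ℝ) < s := lt_of_le_of_ne s.2 (fun h => hs (NNReal.eq h.symm))
    -- The densities cross at the midpoint, and the half-line below it maximizes the difference of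
    -- probabilities.
    have hset : {x | 0 ≤ gaussianPDFReal a s x - gaussianPDFReal b s x} = Iic ((a + b) / 2) := by
      ext x
      have hc : 0 < (√(2 * Real.pi * s))⁻¹ := by positivity
      simp only [mem_ofPred_eq, mem_Iic, sub_nonneg, gaussianPDFReal]
      rw [mul_le_mul_iff_right₀ hc, Real.exp_le_exp, div_le_div_iff_of_pos_right (by positivity)]
      constructor <;> intro h <;> nlinarith
    calc (gaussianReal a s).real A - (gaussianReal b s).real A
        = ∫ x in A, (gaussianPDFReal a s x - gaussianPDFReal b s x) := by
          rw [hreal, hreal, integral_sub (hi a).integrableOn (hi b).integrableOn]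
      _ ≤ ∫ x in Iic ((a + b) / 2), (gaussianPDFReal a s x - gaussianPDFReal b s x) := by
          rw [← hset]
          exact setIntegral_le_nonneg hA
            ((stronglyMeasurable_gaussianPDFReal a s).sub (stronglyMeasurable_gaussianPDFReal b s))
            ((hi a).sub (hi b))
      _ = (gaussianReal 0 s).real (Iic ((b - a) / 2))
            - (gaussianReal 0 s).real (Iic (-((b - a) / 2))) := by
          rw [integral_sub (hi a).integrableOn (hi b).integrableOn, ← hreal, ← hreal,
            gaussianReal_map_shift a, gaussianReal_map_shift b,
            map_measureReal_apply (by fun_prop) measurableSet_Iic,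
            map_measureReal_apply (by fun_prop) measurableSet_Iic]
          congr 2 <;> · ext x; simp only [mem_preimage, mem_Iic]; constructor <;> intro <;> linarith
      _ = (gaussianReal 0 s).real (Ioc (-((b - a) / 2)) ((b - a) / 2)) := by
          rw [← measureReal_sdiff (Iic_subset_Iic.2 (by linarith)) measurableSet_Iic]
          congr 1; ext x; simp [and_comm]
      -- The constant is the peak of the normal density, and the interval has length `b - a`.
      _ ≤ ∫ x in Ioc (-((b - a) / 2)) ((b - a) / 2), (√(2 * Real.pi * s))⁻¹ := by
          rw [hreal]
          refine setIntegral_mono (hi 0).integrableOn (integrableOn_const (by simp)) fun x => ?_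
          refine mul_le_of_le_one_right (by positivity) (Real.exp_le_one_iff.2 ?_)
          rw [neg_div]
          exact neg_nonpos.2 (by positivity)
      _ = (√(2 * Real.pi * s))⁻¹ * (b - a) := by
          rw [setIntegral_const, smul_eq_mul, Real.volume_real_Ioc_of_le (by linarith)]
          ring
  have hcompl : ∀ c, (gaussianReal c s).real Aᶜ = 1 - (gaussianReal c s).real A := fun c =>
    probReal_compl_eq_one_sub hA
  rcases lt_trichotomy a b with h | rfl | h
  · have h1 := key h hA
    have h2 := key h hA.compl
    rw [hcompl, hcompl] at h2
    rw [abs_sub_comm a, abs_of_pos (sub_pos.2 h), abs_le]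
    constructor <;> linarith
  · simp
  · have h1 := key h hA
    have h2 := key h hA.compl
    rw [hcompl, hcompl] at h2
    rw [abs_of_pos (sub_pos.2 h), abs_le]
    constructor <;> linarith

end Gaussian

/-! ### Geometric decay of Lipschitz constants along the chain. -/

section Chain

variable {Ω : Type*} [MeasurableSpace Ω] {P : Measure Ω} {X : Ω → ℝ}
  {κl : Kernel ℝ Ω} {κc : Kernel Ω ℝ} [IsMarkovKernel κl] [IsMarkovKernel κc] {τ V : ℝ} {s : ℝ≥0}

lemma integral_comp_tilted_gaussian (hl : ∀ t, κl t = P.tilted (t * X ·))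
    (hc : ∀ ω, κc ω = gaussianReal (τ⁻¹ * X ω) s) {f : ℝ → ℝ} (hf : Measurable f) {B : ℝ}
    (hB : ∀ x, |f x| ≤ B) (t : ℝ) :
    ∫ y, f y ∂(κc ∘ₖ κl) t
      = ∫ ω, (fun x => ∫ y, f y ∂gaussianReal (τ⁻¹ * x) s) (X ω) ∂P.tilted (t * X ·) := by
  have hi : Integrable f ((κc ∘ₖ κl) t) :=
    Integrable.of_bound (C := B) hf.aestronglyMeasurable (ae_of_all _ hB)
  rw [Kernel.integral_comp hi, hl]
  simp only [hc]

/-- The transition probabilities of a chain that draws `ω` from an exponential family and then a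
normal variable with mean `X ω / τ` are Lipschitz, with geometrically decaying constants. -/
lemma abs_pow_comp_tilted_gaussian_sub_le [IsProbabilityMeasure P]
    (hexp : ∀ t, Integrable (fun ω => Real.exp (t * X ω)) P)
    (hτ : 0 < τ) (hs : s ≠ 0) (hl : ∀ t, κl t = P.tilted (t * X ·))
    (hc : ∀ ω, κc ω = gaussianReal (τ⁻¹ * X ω) s)
    (hV : ∀ t, iteratedDeriv 2 (cgf X P) t ≤ V) (m : ℕ) (hm : m ≠ 0) (A : Set ℝ)
    (hA : MeasurableSet A) (x y : ℝ) :
    |(((κc ∘ₖ κl) ^ m) x).real A - (((κc ∘ₖ κl) ^ m) y).real A|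
      ≤ (√(2 * Real.pi * s))⁻¹ * (τ⁻¹ * V) ^ m * |x - y| := by
  have hτ' : 0 ≤ τ⁻¹ := inv_nonneg.2 hτ.le
  have hscale : ∀ x y : ℝ, |τ⁻¹ * x - τ⁻¹ * y| = τ⁻¹ * |x - y| := fun x y => by
    rw [← mul_sub, abs_mul, abs_of_nonneg hτ']
  induction m, Nat.one_le_iff_ne_zero.2 hm using Nat.le_induction generalizing x y with
  | base =>
    -- The first step needs the total variation bound for normal laws, as the indicator of `A` has
    -- no Lipschitz constant; later steps start from a Lipschitz function.
    have hr : ∀ t, ((κc ∘ₖ κl) t).real A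
        = ∫ ω, (fun x => (gaussianReal (τ⁻¹ * x) s).real A) (X ω) ∂P.tilted (t * X ·) := by
      intro t
      rw [← integral_indicator_one hA, integral_comp_tilted_gaussian hl hc (B := 1)
        (measurable_one.indicator hA)]
      · simp only [integral_indicator_one hA]
      · intro x
        by_cases h : x ∈ A <;> simp [h]
    rw [pow_one, pow_one, hr, hr]
    refine (abs_integral_tilted_sub_le hexp
      (g := fun x => (gaussianReal (τ⁻¹ * x) s).real A) (l := (√(2 * Real.pi * s))⁻¹ * τ⁻¹)
      (fun x y => ?_) hV x y).trans_eq ?_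
    on_goal 2 => ring
    refine (abs_gaussianReal_real_sub_le hs hA _ _).trans_eq ?_
    rw [hscale]; ring
  | succ m hm1 ih =>
    have ih := ih (Nat.one_le_iff_ne_zero.1 hm1)
    set f : ℝ → ℝ := fun b => (((κc ∘ₖ κl) ^ m) b).real A with hf
    have hfm : Measurable f := (((κc ∘ₖ κl) ^ m).measurable_coe hA).ennreal_toReal
    have hf1 : ∀ x, |f x| ≤ 1 := fun x => by
      rw [abs_of_nonneg measureReal_nonneg]; exact measureReal_le_one
    have hr : ∀ t, (((κc ∘ₖ κl) ^ (m + 1)) t).real A = ∫ b, f b ∂(κc ∘ₖ κl) t := fun t => by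
      rw [pow_succ]
      exact measureReal_bind ((κc ∘ₖ κl) ^ m) ((κc ∘ₖ κl) t) hA
    rw [hr, hr, integral_comp_tilted_gaussian hl hc hfm hf1,
      integral_comp_tilted_gaussian hl hc hfm hf1]
    -- The scaling of the normal mean contributes `τ⁻¹` and the exponential family contributes `V`.
    refine (abs_integral_tilted_sub_le hexp
      (g := fun x => ∫ y, f y ∂gaussianReal (τ⁻¹ * x) s)
      (l := (√(2 * Real.pi * s))⁻¹ * (τ⁻¹ * V) ^ m * τ⁻¹) (fun x y => ?_) hV x y).trans_eq ?_
    on_goal 2 => ring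
    refine (abs_integral_gaussianReal_sub_le hfm hf1 ih _ _ s).trans_eq ?_
    rw [hscale]; ring

end Chain

/-! ### Invariance of the posterior. -/

section Invariance

variable {Ω : Type*} [MeasurableSpace Ω] {P : Measure Ω} [IsProbabilityMeasure P] {X : Ω → ℝ}
  {κl : Kernel ℝ Ω} {κc : Kernel Ω ℝ} {τ c : ℝ}
  {w : ℝ → ℝ}

/-- Complete the square in `b`: this identifies the conditional law of the coefficient given the
latent variables. -/
lemma exp_mul_sub_sq_eq_gaussianPDFReal (hτ : 0 < τ) (x b : ℝ) :
    Real.exp (b * x - τ / 2 * b ^ 2)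
      = (√(2 * Real.pi * τ⁻¹) * Real.exp (x ^ 2 / (2 * τ)))
        * gaussianPDFReal (τ⁻¹ * x) (Real.toNNReal τ⁻¹) b := by
  have hs : ((Real.toNNReal τ⁻¹ : ℝ≥0) : ℝ) = τ⁻¹ := Real.coe_toNNReal _ (inv_nonneg.2 hτ.le)
  have hpos : 0 < √(2 * Real.pi * τ⁻¹) := Real.sqrt_pos.2 (by positivity)
  rw [gaussianPDFReal, hs]
  have : (√(2 * Real.pi * τ⁻¹) * Real.exp (x ^ 2 / (2 * τ)))
        * ((√(2 * Real.pi * τ⁻¹))⁻¹ * Real.exp (-(b - τ⁻¹ * x) ^ 2 / (2 * τ⁻¹)))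
      = (√(2 * Real.pi * τ⁻¹) * (√(2 * Real.pi * τ⁻¹))⁻¹)
        * (Real.exp (x ^ 2 / (2 * τ)) * Real.exp (-(b - τ⁻¹ * x) ^ 2 / (2 * τ⁻¹))) := by ring
  rw [this, mul_inv_cancel₀ hpos.ne', one_mul, ← Real.exp_add]
  congr 1
  field_simp
  ring

/-- The measure with density proportional to `mgf X P b * exp (-τ b² / 2)` is invariant under the
chain that draws `ω` from the exponential family generated by `X` and then a normal variable with
mean `X ω / τ` and variance `1 / τ`. -/
lemma withDensity_bind_eq_self (hX : Measurable X)
    (hexp : ∀ t, Integrable (fun ω => Real.exp (t * X ω)) P)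
    (hτ : 0 < τ) (hc0 : 0 < c) (hl : ∀ t, κl t = P.tilted (t * X ·))
    (hc : ∀ ω, κc ω = gaussianReal (τ⁻¹ * X ω) (Real.toNNReal τ⁻¹))
    (hw : ∀ b, w b = c * mgf X P b * Real.exp (-(τ / 2 * b ^ 2))) :
    (volume.withDensity fun b => ENNReal.ofReal (w b)).bind (κc ∘ₖ κl)
      = volume.withDensity fun b => ENNReal.ofReal (w b) := by
  set s := Real.toNNReal τ⁻¹ with hs
  have hs0 : s ≠ 0 := by simpa [hs] using hτ
  have hmgf : ∀ b, 0 < mgf X P b := fun b => mgf_pos (hexp b)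
  have hwm : Measurable fun b => ENNReal.ofReal (w b) := by
    have : Measurable (mgf X P) := (continuous_mgf hexp).measurable
    simp only [hw]
    fun_prop
  set D : Ω → ℝ≥0∞ := fun ω =>
    ENNReal.ofReal (c * (√(2 * Real.pi * τ⁻¹) * Real.exp (X ω ^ 2 / (2 * τ)))) with hD
  have hDm : Measurable D := by fun_prop
  -- `h` is the joint density of coefficient and latent variables. It factors as `w b` times the
  -- tilted density (`h_tilt`) and as `D ω` times a normal density (`h_pdf`), so each half-step
  -- draws from a conditional law of `h`.
  set h : ℝ → Ω → ℝ≥0∞ := fun b ω =>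
    ENNReal.ofReal (c * Real.exp (b * X ω - τ / 2 * b ^ 2)) with hh
  have hhm : Measurable (Function.uncurry h) := by
    simp only [hh, Function.uncurry_def]; fun_prop
  have h_lint : ∀ b, ∫⁻ ω, h b ω ∂P = ENNReal.ofReal (w b) := fun b => by
    have hfac : ∀ ω, c * Real.exp (b * X ω - τ / 2 * b ^ 2)
        = c * Real.exp (-(τ / 2 * b ^ 2)) * Real.exp (b * X ω) := fun ω => by
      rw [sub_eq_add_neg, Real.exp_add]; ring
    simp only [hh, hfac]
    rw [← ofReal_integral_eq_lintegral_ofReal ((hexp b).const_mul _)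
      (ae_of_all _ fun ω => by positivity), integral_const_mul, hw]
    congr 1
    rw [mgf]
    ring
  have h_pdf : ∀ b ω, h b ω = D ω * gaussianPDF (τ⁻¹ * X ω) s b := fun b ω => by
    rw [hh, hD, gaussianPDF, ← ENNReal.ofReal_mul (by positivity)]
    simp only
    rw [exp_mul_sub_sq_eq_gaussianPDFReal hτ, ← hs, ← mul_assoc]
  have h_tilt : ∀ b ω, ENNReal.ofReal (w b)
      * ENNReal.ofReal (Real.exp (b * X ω) / ∫ ω, Real.exp (b * X ω) ∂P) = h b ω := fun b ω => by
    have hb := hmgf b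
    rw [← ENNReal.ofReal_mul (by rw [hw]; positivity), hw, hh]
    congr 1
    change c * mgf X P b * _ * (_ / mgf X P b) = _
    rw [sub_eq_add_neg, Real.exp_add]
    field_simp
  ext A hA
  have hNm : Measurable fun ω => κc ω A := κc.measurable_coe hA
  have hN : ∀ ω, κc ω A = ∫⁻ b in A, gaussianPDF (τ⁻¹ * X ω) s b := fun ω => by
    rw [hc, gaussianReal_apply _ hs0]
  rw [Measure.bind_apply hA (Kernel.aemeasurable _),
    lintegral_withDensity_eq_lintegral_mul _ hwm (Kernel.measurable_coe _ hA),
    withDensity_apply _ hA]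
  calc ∫⁻ b, ((fun b => ENNReal.ofReal (w b)) * fun b => (κc ∘ₖ κl) b A) b
      = ∫⁻ b, ∫⁻ ω, h b ω * κc ω A ∂P := by
        refine lintegral_congr fun b => ?_
        simp only [Pi.mul_apply]
        rw [Kernel.comp_apply' _ _ _ hA, hl, lintegral_tilted, ← lintegral_const_mul _ (by fun_prop)]
        refine lintegral_congr fun ω => ?_
        rw [← mul_assoc, h_tilt]
    _ = ∫⁻ ω, (∫⁻ b, h b ω * κc ω A) ∂P := by
        refine lintegral_lintegral_swap (Measurable.aemeasurable ?_)
        exact hhm.mul (hNm.comp measurable_snd)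
    _ = ∫⁻ ω, D ω * κc ω A ∂P := by
        refine lintegral_congr fun ω => ?_
        rw [lintegral_mul_const _ (hhm.of_uncurry_right)]
        simp only [h_pdf]
        rw [lintegral_const_mul _ (measurable_gaussianPDF _ _), lintegral_gaussianPDF_eq_one _ hs0,
          mul_one]
    _ = ∫⁻ ω, (∫⁻ b in A, h b ω) ∂P := by
        refine lintegral_congr fun ω => ?_
        simp only [h_pdf]
        rw [lintegral_const_mul _ (measurable_gaussianPDF _ _), hN]
    _ = ∫⁻ b in A, ∫⁻ ω, h b ω ∂P :=
        (lintegral_lintegral_swap hhm.aemeasurable).symm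
    _ = ∫⁻ b in A, ENNReal.ofReal (w b) := by simp only [h_lint]

end Invariance

/-! ### Finite mass and moments of the posterior, by domination by the prior. -/

section Normalization

variable {w : ℝ → ℝ} {Q : ℝ}

lemma integrable_sq_mul_gaussian_bound (hQ : 0 < Q) :
    Integrable fun b : ℝ => (1 + b ^ 2) * Real.exp (-(Q / 2) * b ^ 2) := by
  have h0 : Integrable fun b : ℝ => Real.exp (-(Q / 2) * b ^ 2) :=
    integrable_exp_neg_mul_sq (by positivity)
  have h2 := integrable_rpow_mul_exp_neg_mul_sq (b := Q / 2) (by positivity) (s := 2) (by norm_num)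
  refine (h0.add h2).congr (ae_of_all _ fun b => ?_)
  simp only [Pi.add_apply, Real.rpow_two]
  ring

lemma withDensity_ne_zero_and_ne_top (hQ : 0 < Q) (hwm : Measurable w) (hw0 : ∀ b, 0 < w b)
    (hw1 : ∀ b, w b ≤ Real.exp (-(Q / 2) * b ^ 2)) :
    (volume.withDensity fun b => ENNReal.ofReal (w b)) univ ≠ 0 ∧
      (volume.withDensity fun b => ENNReal.ofReal (w b)) univ ≠ ∞ := by
  rw [withDensity_apply _ MeasurableSet.univ, Measure.restrict_univ]
  constructor
  · rw [Ne, lintegral_eq_zero_iff (by fun_prop)]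
    intro h
    have h' : ∀ᵐ b : ℝ, False := h.mono fun b hb => by
      have := hw0 b
      simp only [Pi.zero_apply, ENNReal.ofReal_eq_zero] at hb
      linarith
    simp only [eventually_false_iff_eq_bot, ae_eq_bot] at h'
    exact NeZero.ne _ h'
  · refine (Integrable.lintegral_lt_top ?_).ne
    refine Integrable.mono' (integrable_exp_neg_mul_sq (b := Q / 2) (by positivity))
      hwm.aestronglyMeasurable (ae_of_all _ fun b => ?_)
    rw [Real.norm_of_nonneg (hw0 b).le]
    exact hw1 b

lemma integrable_withDensity_of_abs_le (hQ : 0 < Q) (hwm : Measurable w) (hw0 : ∀ b, 0 < w b)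
    (hw1 : ∀ b, w b ≤ Real.exp (-(Q / 2) * b ^ 2)) {f : ℝ → ℝ} (hf : Measurable f)
    (hf1 : ∀ b, |f b| ≤ 1 + b ^ 2) :
    Integrable f ((volume.withDensity fun b => ENNReal.ofReal (w b))[|univ]) := by
  rw [ProbabilityTheory.cond, Measure.restrict_univ]
  refine Integrable.smul_measure ?_
    (ENNReal.inv_ne_top.2 (withDensity_ne_zero_and_ne_top hQ hwm hw0 hw1).1)
  rw [integrable_withDensity_iff (by fun_prop) (ae_of_all _ fun _ => ENNReal.ofReal_lt_top)]
  refine Integrable.mono' (integrable_sq_mul_gaussian_bound hQ) (by fun_prop)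
    (ae_of_all _ fun b => ?_)
  rw [ENNReal.toReal_ofReal (hw0 b).le, norm_mul, Real.norm_eq_abs, Real.norm_of_nonneg (hw0 b).le]
  exact mul_le_mul (hf1 b) (hw1 b) (hw0 b).le (by positivity)

lemma cond_univ_bind_eq_self {M : Measure ℝ} {K : Kernel ℝ ℝ} (h : M.bind K = M) :
    (M[|univ]).bind K = M[|univ] := by
  rw [ProbabilityTheory.cond, Measure.restrict_univ]
  rw [Measure.comp_smul, h]

end Normalization

/-! ### Truncated normals and their products as exponential tilts. -/

section Tilted

lemma eq_of_eq_smul_of_isProbabilityMeasure {Ω : Type*} [MeasurableSpace Ω] {μ ν : Measure Ω}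
    [IsProbabilityMeasure μ] [IsProbabilityMeasure ν] {c : ℝ≥0∞} (h : μ = c • ν) : μ = ν := by
  have hc : c = 1 := by
    have := congrArg (fun m : Measure Ω => m univ) h
    simpa using this.symm
  rw [h, hc, one_smul]

lemma gaussianReal_eq_smul_withDensity (t : ℝ) :
    gaussianReal t 1 = ENNReal.ofReal (Real.exp (-(t ^ 2 / 2))) •
      (gaussianReal 0 1).withDensity fun x => ENNReal.ofReal (Real.exp (t * x)) := by
  have hm : Measurable fun x : ℝ => ENNReal.ofReal (Real.exp (t * x)) := by fun_prop
  rw [gaussianReal_of_var_ne_zero t one_ne_zero, gaussianReal_of_var_ne_zero 0 one_ne_zero,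
    ← withDensity_mul _ (measurable_gaussianPDF 0 1) hm,
    ← withDensity_smul _ ((measurable_gaussianPDF 0 1).mul hm)]
  congr 1
  ext x
  simp only [Pi.smul_apply, Pi.mul_apply, smul_eq_mul, gaussianPDF]
  rw [← ENNReal.ofReal_mul (gaussianPDFReal_nonneg _ _ _), ← ENNReal.ofReal_mul (by positivity)]
  congr 1
  simp only [gaussianPDFReal, NNReal.coe_one, mul_one]
  rw [mul_left_comm, mul_assoc, ← Real.exp_add, ← Real.exp_add]
  congr 2
  ring

lemma integrable_exp_mul_truncNormal (b : Bool) (t : ℝ) :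
    Integrable (fun x => Real.exp (t * x)) (truncNormal 0 b) := by
  have h := gaussianReal_absolutelyContinuous' 0 (one_ne_zero (α := ℝ≥0))
  refine Integrable.smul_measure (integrable_exp_mul_gaussianReal t).integrableOn
    (ENNReal.inv_ne_top.2 fun h0 => ?_)
  have h' := h h0
  cases b <;> simp [halfLine] at h'

/-- Both sides are multiples of the same measure `R`. Being probability measures they coincide, so
the normalizing constants need not be compared. -/
lemma truncNormal_eq_tilted (t : ℝ) (b : Bool) :
    truncNormal t b = (truncNormal 0 b).tilted (t * ·) := by
  have : IsProbabilityMeasure ((truncNormal 0 b).tilted (t * ·)) :=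
    isProbabilityMeasure_tilted (integrable_exp_mul_truncNormal b t)
  set E : ℝ → ℝ≥0∞ := fun x => ENNReal.ofReal (Real.exp (t * x)) with hE
  have hEm : Measurable E := by fun_prop
  set Z := ∫ x, Real.exp (t * x) ∂truncNormal 0 b with hZ
  have hZ0 : 0 < Z := integral_exp_pos (integrable_exp_mul_truncNormal b t)
  set R := ((gaussianReal 0 1).restrict (halfLine b)).withDensity E with hR
  have h1 : truncNormal t b = ((gaussianReal t 1 (halfLine b))⁻¹
      * ENNReal.ofReal (Real.exp (-(t ^ 2 / 2)))) • R := by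
    rw [truncNormal, ProbabilityTheory.cond, mul_smul]
    congr 1
    rw [gaussianReal_eq_smul_withDensity t, Measure.restrict_smul,
      restrict_withDensity (measurableSet_halfLine b)]
  have h2 : (truncNormal 0 b).tilted (t * ·) = (ENNReal.ofReal Z⁻¹
      * (gaussianReal 0 1 (halfLine b))⁻¹) • R := by
    rw [Measure.tilted, ← hZ]
    have : (fun x => ENNReal.ofReal (Real.exp (t * x) / Z)) = ENNReal.ofReal Z⁻¹ • E := by
      ext x
      simp only [Pi.smul_apply, smul_eq_mul, hE]
      rw [← ENNReal.ofReal_mul (by positivity), div_eq_inv_mul]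
    rw [this, withDensity_smul _ hEm, truncNormal, ProbabilityTheory.cond,
      withDensity_smul_measure, ← mul_smul]
  have hA0 : gaussianReal 0 1 (halfLine b) ≠ 0 := fun h0 => by
    have h' := gaussianReal_absolutelyContinuous' 0 (one_ne_zero (α := ℝ≥0)) h0
    cases b <;> simp [halfLine] at h'
  have hd0 : ENNReal.ofReal Z⁻¹ * (gaussianReal 0 1 (halfLine b))⁻¹ ≠ 0 := by
    have : (gaussianReal 0 1 (halfLine b)) ≠ ∞ := measure_ne_top _ _
    simp [hZ0, this]
  have hd1 : ENNReal.ofReal Z⁻¹ * (gaussianReal 0 1 (halfLine b))⁻¹ ≠ ∞ :=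
    ENNReal.mul_ne_top ENNReal.ofReal_ne_top (ENNReal.inv_ne_top.2 hA0)
  refine eq_of_eq_smul_of_isProbabilityMeasure (c := ((gaussianReal t 1 (halfLine b))⁻¹
      * ENNReal.ofReal (Real.exp (-(t ^ 2 / 2))))
      * (ENNReal.ofReal Z⁻¹ * (gaussianReal 0 1 (halfLine b))⁻¹)⁻¹) ?_
  rw [h2, h1, ← mul_smul, mul_assoc, ENNReal.inv_mul_cancel hd0 hd1, mul_one]

variable {ι : Type*} [Fintype ι]

lemma integral_exp_mul_sum_pi (μ : ι → Measure ℝ) [∀ i, SigmaFinite (μ i)] (t : ℝ) :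
    ∫ ω : ι → ℝ, Real.exp (t * ∑ i, ω i) ∂Measure.pi μ = ∏ i, ∫ x, Real.exp (t * x) ∂μ i := by
  rw [← integral_fintype_prod_eq_prod]
  simp only [Finset.mul_sum, Real.exp_sum]

lemma integrable_exp_mul_sum_pi (μ : ι → Measure ℝ) [∀ i, SigmaFinite (μ i)] {t : ℝ}
    (h : ∀ i, Integrable (fun x => Real.exp (t * x)) (μ i)) :
    Integrable (fun ω : ι → ℝ => Real.exp (t * ∑ i, ω i)) (Measure.pi μ) := by
  simp only [Finset.mul_sum, Real.exp_sum]
  exact Integrable.fintype_prod h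

/-- The exponential of a sum is a product, so both the weight and its normalizing constant factor
over coordinates. -/
lemma pi_tilted (μ : ι → Measure ℝ) [∀ i, IsProbabilityMeasure (μ i)] {t : ℝ}
    (h : ∀ i, Integrable (fun x => Real.exp (t * x)) (μ i)) :
    Measure.pi (fun i => (μ i).tilted (t * ·))
      = (Measure.pi μ).tilted fun ω => t * ∑ i, ω i := by
  have hp : ∀ i, IsProbabilityMeasure ((μ i).tilted (t * ·)) := fun i =>
    isProbabilityMeasure_tilted (h i)
  refine Measure.pi_eq fun s hs => ?_
  rw [tilted_apply_eq_ofReal_integral' _ (MeasurableSet.univ_pi hs), integral_exp_mul_sum_pi,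
    Measure.restrict_pi_pi, integral_div, integral_exp_mul_sum_pi, ← Finset.prod_div_distrib,
    ENNReal.ofReal_prod_of_nonneg]
  · refine Finset.prod_congr rfl fun i _ => ?_
    rw [tilted_apply_eq_ofReal_integral' _ (hs i), integral_div]
  · intro i _
    exact div_nonneg (integral_nonneg fun x => (Real.exp_pos _).le)
      (integral_nonneg fun x => (Real.exp_pos _).le)

end Tilted

/-! ### The variance of a truncated normal. -/

section Variance

lemma hasDerivAt_gaussianPDFReal (t x : ℝ) :
    HasDerivAt (gaussianPDFReal t 1) (-(x - t) * gaussianPDFReal t 1 x) x := by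
  have h : HasDerivAt (fun x : ℝ => -(x - t) ^ 2 / (2 * (1 : ℝ≥0))) (-(x - t)) x := by
    have h1 := ((((hasDerivAt_id x).sub_const t).pow 2).neg).div_const (2 * ((1 : ℝ≥0) : ℝ))
    refine h1.congr_deriv ?_
    simp
    ring
  refine (h.exp.const_mul (√(2 * Real.pi * (1 : ℝ≥0)))⁻¹).congr_deriv ?_
  rw [gaussianPDFReal]
  ring

lemma integrable_pow_mul_gaussianPDFReal (t : ℝ) (k : ℕ) :
    Integrable fun x => x ^ k * gaussianPDFReal t 1 x := by
  have h : Integrable (fun x : ℝ => x ^ k) (gaussianReal t 1) :=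
    integrable_pow_of_mem_interior_integrableExpSet (X := id)
      (by simp [integrableExpSet_id_gaussianReal]) k
  rw [gaussianReal_of_var_ne_zero t one_ne_zero, integrable_withDensity_iff
    (measurable_gaussianPDF t 1) (ae_of_all _ fun _ => gaussianPDF_lt_top)] at h
  simpa only [toReal_gaussianPDF] using h

/-- Integrate the derivative of `x ^ (k + 1) * p x`. It vanishes at both ends; the lowest moment,
treated next, keeps the boundary term at `0`. -/
lemma integral_Ioi_pow_mul_gaussianPDFReal (t : ℝ) (k : ℕ) :
    ∫ x in Ioi (0 : ℝ), x ^ (k + 2) * gaussianPDFReal t 1 x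
      = t * (∫ x in Ioi (0 : ℝ), x ^ (k + 1) * gaussianPDFReal t 1 x)
        + (k + 1) * ∫ x in Ioi (0 : ℝ), x ^ k * gaussianPDFReal t 1 x := by
  have hi : ∀ k : ℕ, IntegrableOn (fun x => x ^ k * gaussianPDFReal t 1 x) (Ioi 0) := fun k =>
    (integrable_pow_mul_gaussianPDFReal t k).integrableOn
  set p := gaussianPDFReal t 1 with hp
  have hd : ∀ x, HasDerivAt (fun x => x ^ (k + 1) * p x)
      ((k + 1) * (x ^ k * p x) + t * (x ^ (k + 1) * p x) - x ^ (k + 2) * p x) x := fun x => by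
    refine ((hasDerivAt_pow (k + 1) x).mul (hasDerivAt_gaussianPDFReal t x)).congr_deriv ?_
    push_cast
    ring
  have h1 := ((hi k).const_mul ((k : ℝ) + 1)).add ((hi (k + 1)).const_mul t)
  have hint := h1.sub (hi (k + 2))
  have h := integral_Ioi_of_hasDerivAt_of_tendsto (hd 0).continuousAt.continuousWithinAt
    (fun x _ => hd x) hint (tendsto_zero_of_hasDerivAt_of_integrableOn_Ioi (fun x _ => hd x) hint
      (hi (k + 1)))
  have hsplit : ∫ x in Ioi (0 : ℝ),
        ((k + 1) * (x ^ k * p x) + t * (x ^ (k + 1) * p x) - x ^ (k + 2) * p x)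
      = ((k + 1) * (∫ x in Ioi (0 : ℝ), x ^ k * p x)
        + t * ∫ x in Ioi (0 : ℝ), x ^ (k + 1) * p x) - ∫ x in Ioi (0 : ℝ), x ^ (k + 2) * p x := by
    rw [← integral_const_mul, ← integral_const_mul,
      ← integral_add ((hi k).const_mul _) ((hi (k + 1)).const_mul _)]
    exact integral_sub h1 (hi (k + 2))
  rw [hsplit] at h
  simp only [ne_eq, Nat.add_eq_zero_iff, one_ne_zero, and_false, not_false_eq_true, zero_pow,
    zero_mul, sub_zero] at h
  linarith

lemma integral_Ioi_mul_gaussianPDFReal (t : ℝ) :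
    ∫ x in Ioi (0 : ℝ), x * gaussianPDFReal t 1 x
      = t * (∫ x in Ioi (0 : ℝ), gaussianPDFReal t 1 x) + gaussianPDFReal t 1 0 := by
  have hi0 : IntegrableOn (gaussianPDFReal t 1) (Ioi 0) :=
    (integrable_gaussianPDFReal t 1).integrableOn
  have hi1 : IntegrableOn (fun x => x * gaussianPDFReal t 1 x) (Ioi 0) := by
    simpa using (integrable_pow_mul_gaussianPDFReal t 1).integrableOn (s := Ioi 0)
  set p := gaussianPDFReal t 1 with hp
  have hd : ∀ x, HasDerivAt p (t * p x - x * p x) x := fun x =>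
    (hasDerivAt_gaussianPDFReal t x).congr_deriv (by ring)
  have hint := (hi0.const_mul t).sub hi1
  have h := integral_Ioi_of_hasDerivAt_of_tendsto (hd 0).continuousAt.continuousWithinAt
    (fun x _ => hd x) hint (tendsto_zero_of_hasDerivAt_of_integrableOn_Ioi (fun x _ => hd x) hint
      hi0)
  have hsplit : ∫ x in Ioi (0 : ℝ), (t * p x - x * p x)
      = t * (∫ x in Ioi (0 : ℝ), p x) - ∫ x in Ioi (0 : ℝ), x * p x := by
    rw [← integral_const_mul]
    exact integral_sub (hi0.const_mul _) hi1
  rw [hsplit] at h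
  linarith

lemma integral_truncNormal_true (t : ℝ) (f : ℝ → ℝ) :
    ∫ x, f x ∂truncNormal t true = ((gaussianReal t 1).real (Ioi 0))⁻¹
      * ∫ x in Ioi (0 : ℝ), f x * gaussianPDFReal t 1 x := by
  rw [truncNormal, ProbabilityTheory.cond, integral_smul_measure, ENNReal.toReal_inv, smul_eq_mul]
  simp only [halfLine, if_true]
  rw [← integral_indicator measurableSet_Ioi, ← integral_indicator measurableSet_Ioi,
    integral_gaussianReal_eq_integral_smul one_ne_zero, measureReal_def]
  congr 2
  ext x
  by_cases hx : x ∈ Ioi (0 : ℝ) <;> simp [hx, mul_comm]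

/-- A normal distribution with unit variance truncated to `(0,∞)` has variance at most `1`, and at
most `1/2` if the mean of the untruncated distribution is nonpositive. -/
lemma variance_truncNormal_true_le (t : ℝ) :
    Var[id; truncNormal t true] ≤ 1 ∧ (t ≤ 0 → Var[id; truncNormal t true] ≤ 1 / 2) := by
  set p := gaussianPDFReal t 1 with hp
  set J : ℕ → ℝ := fun k => ∫ x in Ioi (0 : ℝ), x ^ k * p x with hJ
  set C := ((gaussianReal t 1).real (Ioi 0))⁻¹ with hC
  have hmom : ∀ k : ℕ, ∫ x, x ^ k ∂truncNormal t true = C * J k := fun k =>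
    integral_truncNormal_true t _
  have h0 : C * J 0 = 1 := by rw [← hmom]; simp
  have hC0 : 0 < C := by
    have : 0 ≤ C := inv_nonneg.2 measureReal_nonneg
    refine this.lt_of_ne fun h => ?_
    rw [← h, zero_mul] at h0
    exact zero_ne_one h0
  have hi : ∀ k : ℕ, IntegrableOn (fun x => x ^ k * p x) (Ioi 0) := fun k =>
    (integrable_pow_mul_gaussianPDFReal t k).integrableOn
  have hppos : ∀ x, 0 < p x := fun x => gaussianPDFReal_pos t 1 x one_ne_zero
  have e1 : J 1 = t * J 0 + p 0 := by
    simpa [hJ] using integral_Ioi_mul_gaussianPDFReal t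
  have e2 : J 2 = t * J 1 + J 0 := by
    simpa [hJ] using integral_Ioi_pow_mul_gaussianPDFReal t 0
  have e3 : J 3 = t * J 2 + 2 * J 1 := by
    have := integral_Ioi_pow_mul_gaussianPDFReal t 1
    norm_num at this
    simpa [hJ] using this
  set m := C * J 1 with hm
  have hm2 : C * J 2 = 1 + t * m := by rw [e2, hm]; linear_combination h0
  have hm3 : C * J 3 = t * (1 + t * m) + 2 * m := by rw [e3, hm, ← hm2]; ring
  have hmt : t ≤ m := by
    have : m = t + C * p 0 := by rw [hm, e1]; linear_combination t * h0
    have := mul_pos hC0 (hppos 0)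
    linarith
  have hm0 : 0 ≤ m := mul_nonneg hC0.le
    (setIntegral_nonneg measurableSet_Ioi fun x hx =>
      mul_nonneg (pow_nonneg (le_of_lt hx) 1) (hppos x).le)
  -- This is the mean of `x (x - s)²`. As a quadratic in `s` it encodes the Cauchy–Schwarz
  -- inequality `(E x²)² ≤ E x · E x³`.
  have hquad : ∀ s : ℝ, 0 ≤ C * J 3 - 2 * s * (C * J 2) + s ^ 2 * m := fun s => by
    have hnn : 0 ≤ ∫ x in Ioi (0 : ℝ), (x ^ 3 * p x - 2 * s * (x ^ 2 * p x)
        + s ^ 2 * (x ^ 1 * p x)) := setIntegral_nonneg measurableSet_Ioi fun x hx => by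
      have hx' : 0 < x := hx
      have : x ^ 3 * p x - 2 * s * (x ^ 2 * p x) + s ^ 2 * (x ^ 1 * p x)
          = x * (x - s) ^ 2 * p x := by ring
      rw [this]
      exact mul_nonneg (by positivity) (hppos x).le
    have i1 : IntegrableOn (fun x => 2 * s * (x ^ 2 * p x)) (Ioi 0) := (hi 2).const_mul _
    have i2 : IntegrableOn (fun x => s ^ 2 * (x ^ 1 * p x)) (Ioi 0) := (hi 1).const_mul _
    have i3 : IntegrableOn (fun x => x ^ 3 * p x - 2 * s * (x ^ 2 * p x)) (Ioi 0) := (hi 3).sub i1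
    rw [integral_add i3 i2, integral_sub (hi 3) i1, integral_const_mul, integral_const_mul] at hnn
    have := mul_nonneg hC0.le hnn
    simp only [hm, hJ] at this ⊢
    linarith
  have hvar : Var[id; truncNormal t true] = 1 + t * m - m ^ 2 := by
    have hL : MemLp id 2 (truncNormal t true) :=
      ((memLp_id_gaussianReal' 2 (by simp)).restrict _).smul_measure (ENNReal.inv_ne_top.2 (by
        intro h0
        have h' := gaussianReal_absolutelyContinuous' t (one_ne_zero (α := ℝ≥0)) h0
        simp [halfLine] at h'))
    rw [variance_eq_sub hL]
    have a2 := hmom 2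
    have a1 := hmom 1
    simp only [pow_one] at a1
    change ∫ x, x ^ 2 ∂truncNormal t true - (∫ x, x ∂truncNormal t true) ^ 2 = _
    rw [a2, a1, hm2]
  rw [hvar]
  refine ⟨by nlinarith, fun ht => ?_⟩
  -- The minimizer `s = (1 + t m) / m` turns the quadratic into `(1 + t m)² ≤ m (t (1 + t m) + 2
  -- m)`, which is this bound. Then the variance is `1 + t m - m² ≤ (1 + t m) / 2 ≤ 1/2` for `t ≤
  -- 0`.
  have hkey : 1 + t * m ≤ 2 * m ^ 2 := by
    rw [hm2, hm3] at hquad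
    rcases hm0.eq_or_lt with h | h
    · have := hquad (1 + t ^ 2 + 1)
      rw [← h] at this
      nlinarith [sq_nonneg t, sq_nonneg (t + 1)]
    · have := mul_nonneg hm0 (hquad ((1 + t * m) / m))
      have e : m * (t * (1 + t * m) + 2 * m - 2 * ((1 + t * m) / m) * (1 + t * m)
          + ((1 + t * m) / m) ^ 2 * m) = 2 * m ^ 2 - (1 + t * m) := by
        field_simp
        ring
      linarith
  nlinarith

end Variance

/-! ### Cumulant generating functions of truncated normals. -/

section TruncatedMGF

/-- The probability of the response `b` in the probit model with linear predictor `t`. -/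
def probitLik (b : Bool) (t : ℝ) : ℝ := if b then stdNormalCDF t else 1 - stdNormalCDF t

lemma gaussianReal_real_halfLine (t : ℝ) (b : Bool) :
    (gaussianReal t 1).real (halfLine b) = probitLik b t := by
  have hmap : gaussianReal t 1 = (gaussianReal 0 1).map (t - ·) := by
    rw [gaussianReal_map_const_sub, sub_zero]
  rw [hmap, map_measureReal_apply (by fun_prop) (measurableSet_halfLine b), probitLik, stdNormalCDF,
    cdf_eq_real]
  have : NullSingletonClass (gaussianReal 0 1) := nullSingletonClass_gaussianReal one_ne_zero
  cases b
  · have hpre : (t - ·) ⁻¹' halfLine false = (Iic t)ᶜ := by ext x; simp [halfLine]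
    rw [hpre, probReal_compl_eq_one_sub measurableSet_Iic]
    simp
  · have hpre : (t - ·) ⁻¹' halfLine true = Iio t := by ext x; simp [halfLine]
    rw [hpre, measureReal_congr Iio_ae_eq_Iic]
    simp

lemma probitLik_false (t : ℝ) : probitLik false t = probitLik true (-t) := by
  rw [← gaussianReal_real_halfLine, ← gaussianReal_real_halfLine, ← gaussianReal_map_neg,
    map_measureReal_apply (by fun_prop) (measurableSet_halfLine true)]
  congr 1
  ext x
  simp [halfLine]

lemma probitLik_pos (b : Bool) (t : ℝ) : 0 < probitLik b t := by
  rw [← gaussianReal_real_halfLine]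
  refine ENNReal.toReal_pos (fun h => ?_) (measure_ne_top _ _)
  have h' := gaussianReal_absolutelyContinuous' t (one_ne_zero (α := ℝ≥0)) h
  cases b <;> simp [halfLine] at h'

lemma probitLik_le_one (b : Bool) (t : ℝ) : probitLik b t ≤ 1 := by
  rw [← gaussianReal_real_halfLine]
  exact measureReal_le_one

lemma mgf_truncNormal (b : Bool) (t : ℝ) :
    mgf id (truncNormal 0 b) t = Real.exp (t ^ 2 / 2) * probitLik b t / probitLik b 0 := by
  have h1 : probitLik b t
      = Real.exp (-(t ^ 2 / 2)) * ∫ x in halfLine b, Real.exp (t * x) ∂gaussianReal 0 1 := by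
    rw [← gaussianReal_real_halfLine, measureReal_def, gaussianReal_eq_smul_withDensity,
      Measure.smul_apply, withDensity_apply _ (measurableSet_halfLine b),
      ← ofReal_integral_eq_lintegral_ofReal (integrable_exp_mul_gaussianReal t).integrableOn
        (ae_of_all _ fun x => (Real.exp_pos _).le), smul_eq_mul,
      ← ENNReal.ofReal_mul (Real.exp_pos _).le, ENNReal.toReal_ofReal]
    exact mul_nonneg (Real.exp_pos _).le (integral_nonneg fun x => (Real.exp_pos _).le)
  have h2 : mgf id (truncNormal 0 b) t
      = (probitLik b 0)⁻¹ * ∫ x in halfLine b, Real.exp (t * x) ∂gaussianReal 0 1 := by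
    rw [mgf, truncNormal, ProbabilityTheory.cond, integral_smul_measure, ENNReal.toReal_inv,
      smul_eq_mul, ← gaussianReal_real_halfLine]
    rfl
  have h3 : Real.exp (t ^ 2 / 2) * Real.exp (-(t ^ 2 / 2)) = 1 := by
    rw [← Real.exp_add, add_neg_cancel, Real.exp_zero]
  rw [h2, h1, ← mul_assoc, h3, one_mul, inv_mul_eq_div]

lemma cgf_truncNormal_false (t : ℝ) :
    cgf id (truncNormal 0 false) t = cgf id (truncNormal 0 true) (-t) := by
  rw [cgf, cgf, mgf_truncNormal, mgf_truncNormal, probitLik_false, probitLik_false, neg_zero,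
    neg_sq]

lemma mem_interior_integrableExpSet_truncNormal (b : Bool) (t : ℝ) :
    t ∈ interior (integrableExpSet id (truncNormal 0 b)) :=
  mem_interior_integrableExpSet (integrable_exp_mul_truncNormal b) t

lemma iteratedDeriv_two_cgf_truncNormal_true_le (t : ℝ) :
    iteratedDeriv 2 (cgf id (truncNormal 0 true)) t ≤ 1 ∧
      (t ≤ 0 → iteratedDeriv 2 (cgf id (truncNormal 0 true)) t ≤ 1 / 2) := by
  rw [← variance_tilted_mul (mem_interior_integrableExpSet_truncNormal true t)]
  have := variance_truncNormal_true_le t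
  rw [truncNormal_eq_tilted] at this
  exact this

/-- The second derivative of the cumulant generating function is the variance of the tilted law.
Failures reduce to successes by reflecting `t`. -/
lemma iteratedDeriv_two_cgf_truncNormal_le (b : Bool) (t : ℝ) :
    (t ≤ 0 → iteratedDeriv 2 (cgf id (truncNormal 0 b)) t ≤ 1 - (if b then 1 else 0) / 2) ∧
    (0 ≤ t → iteratedDeriv 2 (cgf id (truncNormal 0 b)) t
      ≤ 1 - (1 - if b then 1 else 0) / 2) := by
  cases b
  · have hfun : cgf id (truncNormal 0 false) = fun t => cgf id (truncNormal 0 true) (-t) :=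
      funext cgf_truncNormal_false
    obtain ⟨h1, h2⟩ := iteratedDeriv_two_cgf_truncNormal_true_le (-t)
    rw [hfun, iteratedDeriv_comp_neg]
    norm_num at h2 ⊢
    exact ⟨fun _ => h1, h2⟩
  · obtain ⟨h1, h2⟩ := iteratedDeriv_two_cgf_truncNormal_true_le t
    norm_num at h2 ⊢
    exact ⟨h2, fun _ => h1⟩

end TruncatedMGF

/-! ### The intercept-only model for a fixed sample. -/

section Model

variable {ι : Type*} [Fintype ι]

/-- The number of successes. -/
def successCount (y : ι → Bool) : ℝ := ∑ i, if y i then (1 : ℝ) else 0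

lemma mgf_sum_truncNormal (y : ι → Bool) (t : ℝ) :
    mgf (fun ω : ι → ℝ => ∑ i, ω i) (Measure.pi fun i => truncNormal 0 (y i)) t
      = ∏ i, mgf id (truncNormal 0 (y i)) t := by
  simp only [mgf]
  exact integral_exp_mul_sum_pi _ t

lemma cgf_sum_truncNormal (y : ι → Bool) :
    cgf (fun ω : ι → ℝ => ∑ i, ω i) (Measure.pi fun i => truncNormal 0 (y i))
      = fun t => ∑ i, cgf id (truncNormal 0 (y i)) t := by
  ext t
  rw [cgf, mgf_sum_truncNormal, Real.log_prod]
  · rfl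
  · intro i _
    exact (mgf_pos (integrable_exp_mul_truncNormal (y i) t)).ne'

/-- Independence adds the variances. For `t ≤ 0` every success saves `1/2`, for `t ≥ 0` every
failure does; the rarer response is guaranteed in both cases. -/
lemma iteratedDeriv_two_cgf_sum_truncNormal_le (y : ι → Bool) (t : ℝ) :
    iteratedDeriv 2
        (cgf (fun ω : ι → ℝ => ∑ i, ω i) (Measure.pi fun i => truncNormal 0 (y i))) t
      ≤ Fintype.card ι - min (successCount y) (Fintype.card ι - successCount y) / 2 := by
  rw [cgf_sum_truncNormal, iteratedDeriv_fun_sum fun i _ =>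
    (analyticAt_cgf (mem_interior_integrableExpSet_truncNormal (y i) t)).contDiffAt]
  have h := fun i => iteratedDeriv_two_cgf_truncNormal_le (y i) t
  rcases le_total t 0 with ht | ht
  · calc _ ≤ ∑ i, (1 - (if y i then (1 : ℝ) else 0) / 2) := by
          exact Finset.sum_le_sum fun i _ => (h i).1 ht
      _ = Fintype.card ι - successCount y / 2 := by
          rw [Finset.sum_sub_distrib, ← Finset.sum_div, successCount]; simp
      _ ≤ _ := by
          have := min_le_left (successCount y) (Fintype.card ι - successCount y)
          linarith
  · calc _ ≤ ∑ i, (1 - (1 - if y i then (1 : ℝ) else 0) / 2) := by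
          exact Finset.sum_le_sum fun i _ => (h i).2 ht
      _ = Fintype.card ι - (Fintype.card ι - successCount y) / 2 := by
          rw [Finset.sum_sub_distrib, ← Finset.sum_div, Finset.sum_sub_distrib, successCount]; simp
      _ ≤ _ := by
          have := min_le_right (successCount y) (Fintype.card ι - successCount y)
          linarith

lemma latentKernel_one_apply (y : ι → Bool) (t : ℝ) :
    latentKernel (fun _ : ι => (1 : ℝ)) y t
      = (Measure.pi fun i => truncNormal 0 (y i)).tilted fun ω => t * ∑ i, ω i := by
  rw [← pi_tilted _ fun i => integrable_exp_mul_truncNormal (y i) t]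
  change Measure.pi (fun i => truncNormal (1 * t) (y i)) = _
  simp only [one_mul, truncNormal_eq_tilted t]

lemma coefKernel_one_apply (Q : ℝ) (z : ι → ℝ) :
    coefKernel (fun _ : ι => (1 : ℝ)) 0 Q z
      = gaussianReal ((Fintype.card ι + Q : ℝ)⁻¹ * ∑ i, z i)
        (Real.toNNReal (Fintype.card ι + Q : ℝ)⁻¹) := by
  change gaussianReal _ _ = _
  simp

lemma posteriorWeight_one (y : ι → Bool) (Q b : ℝ) :
    posteriorWeight (fun _ : ι => (1 : ℝ)) y 0 Q b
      = (∏ i, probitLik (y i) b) * Real.exp (-(Q / 2) * b ^ 2) := by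
  simp only [posteriorWeight, probitLik, one_mul, sub_zero]
  congr 2
  ring

/-- Each likelihood factor is a moment generating function times `exp (-b² / 2)`, up to a constant.
These exponentials raise the precision from `Q` to `n + Q`, the form needed for invariance. -/
lemma posteriorWeight_one_eq_mgf (y : ι → Bool) (Q b : ℝ) :
    posteriorWeight (fun _ : ι => (1 : ℝ)) y 0 Q b
      = (∏ i, probitLik (y i) 0)
        * mgf (fun ω : ι → ℝ => ∑ i, ω i) (Measure.pi fun i => truncNormal 0 (y i)) b
        * Real.exp (-((Fintype.card ι + Q) / 2 * b ^ 2)) := by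
  have hprod : (∏ i, probitLik (y i) 0)
      * mgf (fun ω : ι → ℝ => ∑ i, ω i) (Measure.pi fun i => truncNormal 0 (y i)) b
      = Real.exp (Fintype.card ι * (b ^ 2 / 2)) * ∏ i, probitLik (y i) b := by
    rw [mgf_sum_truncNormal, ← Finset.prod_mul_distrib, Real.exp_nat_mul, ← Finset.card_univ,
      ← Finset.prod_const, ← Finset.prod_mul_distrib]
    refine Finset.prod_congr rfl fun i _ => ?_
    have := (probitLik_pos (y i) 0).ne'
    rw [mgf_truncNormal]
    field_simp
  rw [posteriorWeight_one, hprod, mul_comm (Real.exp _), mul_assoc, ← Real.exp_add]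
  congr 2
  ring

/-- Both convergence rates of Albert and Chib's chain for the intercept-only model are bounded by
the contraction coefficient of the chain with respect to the Wasserstein distance. -/
theorem intercept_rates_le {Q : ℝ} (hQ : 0 < Q) (y : ι → Bool) {κ : ℝ}
    (hκ : κ = (Fintype.card ι + Q : ℝ)⁻¹
      * (Fintype.card ι - min (successCount y) (Fintype.card ι - successCount y) / 2)) :
    geomRate (acKernel (fun _ : ι => (1 : ℝ)) y 0 Q) (posterior (fun _ : ι => (1 : ℝ)) y 0 Q) ≤ κ ∧
    l2GeomRate (acKernel (fun _ : ι => (1 : ℝ)) y 0 Q)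
      (posterior (fun _ : ι => (1 : ℝ)) y 0 Q) ≤ κ := by
  set P := Measure.pi fun i => truncNormal 0 (y i) with hP
  set X : (ι → ℝ) → ℝ := fun ω => ∑ i, ω i with hX
  set τ : ℝ := Fintype.card ι + Q with hτ
  have hτ0 : 0 < τ := by positivity
  have hXm : Measurable X := by fun_prop
  have hexp : ∀ t, Integrable (fun ω => Real.exp (t * X ω)) P := fun t =>
    integrable_exp_mul_sum_pi _ fun i => integrable_exp_mul_truncNormal (y i) t
  have hs : Real.toNNReal τ⁻¹ ≠ 0 := by simpa using hτ0
  set w := posteriorWeight (fun _ : ι => (1 : ℝ)) y 0 Q with hw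
  have hw_mgf : ∀ b, w b = (∏ i, probitLik (y i) 0) * mgf X P b * Real.exp (-(τ / 2 * b ^ 2)) :=
    posteriorWeight_one_eq_mgf y Q
  have hwm : Measurable w := by
    have : Measurable (mgf X P) := (continuous_mgf hexp).measurable
    rw [funext hw_mgf]
    fun_prop
  have hw0 : ∀ b, 0 < w b := fun b => by
    rw [hw, posteriorWeight_one]
    exact mul_pos (Finset.prod_pos fun i _ => probitLik_pos _ _) (Real.exp_pos _)
  have hw1 : ∀ b, w b ≤ Real.exp (-(Q / 2) * b ^ 2) := fun b => by
    rw [hw, posteriorWeight_one]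
    exact mul_le_of_le_one_left (Real.exp_pos _).le
      (Finset.prod_le_one (fun i _ => (probitLik_pos _ _).le) fun i _ => probitLik_le_one _ _)
  have hmass := withDensity_ne_zero_and_ne_top hQ hwm hw0 hw1
  have hprob : IsProbabilityMeasure (posterior (fun _ : ι => (1 : ℝ)) y 0 Q) := by
    have : IsFiniteMeasure (volume.withDensity fun b => ENNReal.ofReal (w b)) :=
      ⟨lt_top_iff_ne_top.2 hmass.2⟩
    exact cond_isProbabilityMeasure hmass.1
  have hinv : (posterior (fun _ : ι => (1 : ℝ)) y 0 Q).bind (acKernel (fun _ : ι => (1 : ℝ)) y 0 Q)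
      = posterior (fun _ : ι => (1 : ℝ)) y 0 Q :=
    cond_univ_bind_eq_self (withDensity_bind_eq_self hXm hexp hτ0
      (Finset.prod_pos fun i _ => probitLik_pos (y i) 0) (latentKernel_one_apply y)
      (coefKernel_one_apply Q) hw_mgf)
  have hP1 : Integrable (fun x : ℝ => |x|) (posterior (fun _ : ι => (1 : ℝ)) y 0 Q) :=
    integrable_withDensity_of_abs_le hQ hwm hw0 hw1 (by fun_prop) fun b => by
      rw [abs_abs]
      nlinarith [sq_nonneg (|b| - 1), sq_abs b, abs_nonneg b]
  have hP2 : Integrable (fun x : ℝ => x ^ 2) (posterior (fun _ : ι => (1 : ℝ)) y 0 Q) :=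
    integrable_withDensity_of_abs_le hQ hwm hw0 hw1 (by fun_prop) fun b => by
      rw [abs_of_nonneg (sq_nonneg b)]
      linarith
  have hcount0 : 0 ≤ successCount y := Finset.sum_nonneg fun i _ => by split_ifs <;> norm_num
  have hcount1 : successCount y ≤ Fintype.card ι := by
    refine (Finset.sum_le_card_nsmul Finset.univ _ 1 fun i _ => ?_).trans_eq (by simp)
    split_ifs <;> norm_num
  have hmin0 : 0 ≤ min (successCount y) (Fintype.card ι - successCount y) :=
    le_min hcount0 (by linarith)
  have hmin1 := min_le_left (successCount y) (Fintype.card ι - successCount y)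
  have hκ' : κ ∈ Icc (0 : ℝ) 1 := by
    rw [hκ, inv_mul_eq_div]
    refine ⟨div_nonneg (by linarith) hτ0.le, (div_le_one hτ0).2 ?_⟩
    linarith
  have hlip : ∀ m : ℕ, m ≠ 0 → ∀ A, MeasurableSet A → ∀ a b : ℝ,
      |((acKernel (fun _ : ι => (1 : ℝ)) y 0 Q ^ m) a).real A
        - ((acKernel (fun _ : ι => (1 : ℝ)) y 0 Q ^ m) b).real A|
      ≤ (√(2 * Real.pi * Real.toNNReal τ⁻¹))⁻¹ * κ ^ m * |a - b| := by
    rw [hκ]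
    exact abs_pow_comp_tilted_gaussian_sub_le hexp hτ0 hs (latentKernel_one_apply y)
      (coefKernel_one_apply Q) (iteratedDeriv_two_cgf_sum_truncNormal_le y)
  have hC : 0 ≤ (√(2 * Real.pi * Real.toNNReal τ⁻¹))⁻¹ := by positivity
  exact ⟨geomRate_le_of_lipschitz hinv hP1 hC hκ' hlip,
    l2GeomRate_le_of_lipschitz hinv hP1 hP2 hC hκ' hlip⟩

end Model

/-! ### Large samples and comparison with Rosenthal's bound. -/

section Asymptotics

lemma successCount_fin_eq (Y : ℕ → Bool) {n : ℕ} (hn : n ≠ 0) :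
    successCount (fun i : Fin n => Y i) = n * successProp Y n := by
  have : (n : ℝ) ≠ 0 := Nat.cast_ne_zero.2 hn
  rw [successCount, successProp, mul_div_cancel₀ _ this,
    Finset.sum_range fun i => if Y i then (1 : ℝ) else 0]

lemma successProp_mem_Icc (Y : ℕ → Bool) (n : ℕ) : successProp Y n ∈ Icc (0 : ℝ) 1 := by
  refine ⟨div_nonneg (Finset.sum_nonneg fun i _ => by split_ifs <;> norm_num) n.cast_nonneg,
    div_le_one_of_le₀ ?_ n.cast_nonneg⟩
  refine (Finset.sum_le_card_nsmul _ _ 1 fun i _ => ?_).trans_eq (by simp)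
  split_ifs <;> norm_num

lemma interceptRates_le_one_sub {Q : ℝ} (hQ : 0 < Q) (Y : ℕ → Bool) {n : ℕ} (hn : n ≠ 0) :
    interceptRate Q Y n ≤ 1 - min (successProp Y n) (1 - successProp Y n) / 2 ∧
    interceptL2Rate Q Y n ≤ 1 - min (successProp Y n) (1 - successProp Y n) / 2 := by
  obtain ⟨h0, h1⟩ := successProp_mem_Icc Y n
  have hn0 : (0 : ℝ) < n := Nat.cast_pos.2 (Nat.pos_of_ne_zero hn)
  have h := intercept_rates_le hQ (fun i : Fin n => Y i) rfl
  set m := min (successProp Y n) (1 - successProp Y n) with hm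
  have hm1 : m ≤ 1 := (min_le_left _ _).trans h1
  have hmin : min (n * successProp Y n) (n - n * successProp Y n) = n * m := by
    rw [hm, mul_min_of_nonneg _ _ hn0.le, mul_sub, mul_one]
  -- The prior precision only helps, so the bound is uniform in `Q`.
  have hle : (n + Q : ℝ)⁻¹ * (n - n * m / 2) ≤ 1 - m / 2 := by
    rw [inv_mul_eq_div, div_le_iff₀ (by positivity)]
    nlinarith
  rw [successCount_fin_eq Y hn, Fintype.card_fin, hmin] at h
  exact ⟨h.1.trans hle, h.2.trans hle⟩

lemma limsup_interceptRates_le {Q : ℝ} (hQ : 0 < Q) (Y : ℕ → Bool) {ε : ℝ}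
    (hε : 2 * ε < min (liminf (successProp Y) atTop) (1 - limsup (successProp Y) atTop)) :
    limsup (interceptRate Q Y) atTop ≤ 1 - ε ∧ limsup (interceptL2Rate Q Y) atTop ≤ 1 - ε := by
  have hev : ∀ᶠ n in atTop, interceptRate Q Y n ≤ 1 - ε ∧ interceptL2Rate Q Y n ≤ 1 - ε := by
    have hlow := eventually_lt_of_lt_liminf (lt_min_iff.1 hε).1
      (isBoundedUnder_of ⟨0, fun n => (successProp_mem_Icc Y n).1⟩)
    have hup := eventually_lt_of_limsup_lt (f := atTop) (u := successProp Y) (b := 1 - 2 * ε)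
      (by linarith [(lt_min_iff.1 hε).2])
      (isBoundedUnder_of ⟨1, fun n => (successProp_mem_Icc Y n).2⟩)
    filter_upwards [hlow, hup, eventually_ne_atTop 0] with n h1 h2 hn
    have hmin : 2 * ε ≤ min (successProp Y n) (1 - successProp Y n) :=
      le_min h1.le (by linarith)
    obtain ⟨h3, h4⟩ := interceptRates_le_one_sub hQ Y hn
    constructor <;> linarith
  exact ⟨limsup_le_of_le (IsCoboundedUnder.of_frequently_ge (a := 0)
      (Eventually.of_forall fun n => geomRate_nonneg _ _).frequently) (hev.mono fun _ h => h.1),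
    limsup_le_of_le (IsCoboundedUnder.of_frequently_ge (a := 0)
      (Eventually.of_forall fun n => l2GeomRate_nonneg _ _).frequently) (hev.mono fun _ h => h.2)⟩

lemma one_sub_le_rosenthalRate {lam L ε d r : ℝ} (hε : ε ∈ Icc (0 : ℝ) 1) (hr : r ∈ Ioo (0 : ℝ) 1) :
    1 - ε ≤ rosenthalRate lam L ε d r :=
  (Real.self_le_rpow_of_le_one (by linarith [hε.2]) (by linarith [hε.1]) hr.2.le).trans
    (le_max_left _ _)

/-- At `r = 0` the second term of the maximum equals `a < 1`; by continuity it stays below `1` for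
small `r > 0`, where `(1 - ε) ^ r < 1` as well. -/
lemma exists_rosenthalRate_lt_one {lam L ε d : ℝ} (hlam : 0 ≤ lam) (hL : 0 ≤ L) (hd : 0 < d)
    (hdL : 2 * L < d * (1 - lam)) (hε : ε ∈ Ioo (0 : ℝ) 1) :
    ∃ r ∈ Ioo (0 : ℝ) 1, rosenthalRate lam L ε d r < 1 := by
  set a := (1 + 2 * L + lam * d) / (1 + d) with ha
  set b := 1 + 2 * (lam * d + L) with hb
  have ha0 : 0 < a := by positivity
  have hb0 : 0 < b := by positivity
  have ha1 : a < 1 := (div_lt_one (by positivity)).2 (by linarith)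
  have hcont : ContinuousAt (fun r : ℝ => a ^ (1 - r) * b ^ r) 0 :=
    (ContinuousAt.rpow continuousAt_const (by fun_prop) (Or.inl ha0.ne')).mul
      (ContinuousAt.rpow continuousAt_const (by fun_prop) (Or.inl hb0.ne'))
  have hev : ∀ᶠ r in nhdsWithin (0 : ℝ) (Ioi 0), a ^ (1 - r) * b ^ r < 1 :=
    (hcont.eventually_lt_const (by simpa using ha1)).filter_mono nhdsWithin_le_nhds
  obtain ⟨r, h1, h2⟩ := (hev.and (Ioo_mem_nhdsGT one_pos)).exists
  exact ⟨r, h2, max_lt (Real.rpow_lt_one (by linarith [hε.2]) (by linarith [hε.1]) h2.1) h1⟩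

/-- The minorization number of Rosenthal's bound is smaller than half of the limiting proportion of
the rarer response. -/
lemma two_mul_minorization_lt {p lam L d ε : ℝ} (hp : 0 < p) (hlam0 : 0 ≤ lam) (hlam1 : lam < 1)
    (hlam : (1 - 2 / Real.pi * p) ^ 2 ≤ lam) (hL : L = 1 + lam) (hd : 2 * L / (1 - lam) < d)
    (hε : ε = (2 : ℝ) ^ (-(1 / 2) : ℝ) * Real.exp (-d)) :
    2 * ε < p := by
  have hpi := Real.pi_gt_three
  have h1 : 0 < 1 - lam := by linarith
  have hd' : 2 * L < d * (1 - lam) := (div_lt_iff₀ h1).1 hd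
  have hd0 : 0 < d := by
    by_contra h
    have := mul_nonneg (sub_nonneg.2 (not_lt.1 h)) h1.le
    linarith
  -- Expanding the square gives `1 - lam ≤ 4 p / π`, and `π > 3`.
  have hgap : 1 - lam ≤ 4 / 3 * p := by
    have h2 : 2 / Real.pi ≤ 2 / 3 := by gcongr
    have h3 : (1 - 2 / Real.pi * p) ^ 2 = 1 - 2 * (2 / Real.pi * p) + (2 / Real.pi * p) ^ 2 := by
      ring
    have h4 := mul_le_mul_of_nonneg_right h2 hp.le
    nlinarith [sq_nonneg (2 / Real.pi * p)]
  -- Since `L ≥ 1`, `2 ≤ 2 L < d (1 - lam) ≤ (4 / 3) d p`. With `d exp (-d) < 1` this yields `(3 /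
  -- 2) exp (-d) < p`.
  have hdp : 3 / 2 < d * p := by nlinarith
  have hexp : Real.exp (-d) * d < 1 := by
    have h2 := Real.add_one_le_exp d
    have h3 : Real.exp (-d) * Real.exp d = 1 := by rw [← Real.exp_add]; simp
    have h4 := Real.exp_pos (-d)
    nlinarith
  have hroot : (2 : ℝ) ^ (-(1 / 2) : ℝ) ≤ 3 / 4 := by
    rw [Real.rpow_neg (by norm_num), ← Real.sqrt_eq_rpow]
    refine inv_le_of_inv_le₀ (by norm_num) ?_
    exact Real.le_sqrt_of_sq_le (by norm_num)
  have hε' : ε ≤ 3 / 4 * Real.exp (-d) := by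
    rw [hε]
    exact mul_le_mul_of_nonneg_right hroot (Real.exp_pos _).le
  have h5 : 3 / 2 * Real.exp (-d) < p := by
    have h4 := Real.exp_pos (-d)
    nlinarith
  linarith

end Asymptotics

end

theorem corollary1 (Q : ℝ) (hQ : 0 < Q) (Y : ℕ → Bool)
    (hinf : 0 < liminf (successProp Y) atTop)
    (hsup : limsup (successProp Y) atTop < 1)
    (δ lam L d ε : ℝ) (hδ : 0 < δ)
    (hδ' : δ < 1 - (1 - 2 / Real.pi *
      min (liminf (successProp Y) atTop) (1 - limsup (successProp Y) atTop)) ^ 2)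
    (hlam : lam = (1 - 2 / Real.pi *
      min (liminf (successProp Y) atTop) (1 - limsup (successProp Y) atTop)) ^ 2 + δ)
    (hL : L = 1 + lam) (hd : 2 * L / (1 - lam) < d)
    (hε : ε = (2 : ℝ) ^ (-(1 / 2) : ℝ) * Real.exp (-d)) :
    (∀ r ∈ Ioo (0 : ℝ) 1,
      limsup (interceptRate Q Y) atTop ≤ rosenthalRate lam L ε d r ∧
      limsup (interceptL2Rate Q Y) atTop ≤ rosenthalRate lam L ε d r) ∧
    ∃ r ∈ Ioo (0 : ℝ) 1, rosenthalRate lam L ε d r < 1 := by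
  have hlam0 : 0 ≤ lam := by rw [hlam]; positivity
  have hlam1 : lam < 1 := by linarith
  have hp : 0 < min (liminf (successProp Y) atTop) (1 - limsup (successProp Y) atTop) :=
    lt_min hinf (by linarith)
  have hL0 : 0 ≤ L := by linarith
  have hd' : 2 * L < d * (1 - lam) := (div_lt_iff₀ (by linarith)).1 hd
  have hd0 : 0 < d := lt_of_le_of_lt (div_nonneg (by linarith) (by linarith)) hd
  have hε2 := two_mul_minorization_lt hp hlam0 hlam1 (by linarith) hL hd hε
  have hε0 : 0 < ε := by rw [hε]; positivity
  have hε1 : ε < 1 := by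
    rw [hε]
    exact mul_lt_one_of_nonneg_of_lt_one_left (by positivity)
      (Real.rpow_lt_one_of_one_lt_of_neg (by norm_num) (by norm_num))
      (Real.exp_le_one_iff.2 (by linarith))
  obtain ⟨h1, h2⟩ := limsup_interceptRates_le hQ Y hε2
  refine ⟨fun r hr => ?_, exists_rosenthalRate_lt_one hlam0 hL0 hd0 hd' ⟨hε0, hε1⟩⟩
  have h3 := one_sub_le_rosenthalRate (lam := lam) (L := L) (d := d) ⟨hε0.le, hε1.le⟩ hr
  exact ⟨h1.trans h3, h2.trans h3⟩
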